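/- Consider the linear regression model $Y=X\theta+u$, where $X$ is a non-random $n\times P$ matrix of rank $P$, $n>P\ge 1$, $\theta\in\mathbb R^P$, and $u\sim N(0,\sigma^2I_n)$ with $\sigma>0$. Let $0\le\mathcal O<P$, let $A$ be a non-random $k\times P$ matrix of rank $k\ge1$, let $c_{\mathcal O}=0$, and let $0<c_p<\infty$ for $\mathcal O<p\le P$. For a matrix $D$ with $P$ columns, $D[p]$ and $D[-p]$ denote its first $p$ and its last $P-p$ columns; for $x\in\mathbb R^P$, $x[p]$ and $x[-p]$ denote its first $p$ and last $P-p$ components. For $0\le p\le P$ let $\tilde\theta(p)\in\mathbb R^P$ be the restricted least-squares estimator, with first $p$ components $(X[p]'X[p])^{-1}X[p]'Y$ and all other components zero. Let $\hat\sigma^2=(n-P)^{-1}\|Y-X\tilde\theta(P)\|^2$, and for $1\le p\le P$ let $\xi_{n,p}=\big([(X[p]'X[p]/n)^{-1}]_{p,p}\big)^{1/2}$. Put $T_0=T_0^*=0$, $T_p=\sqrt n\,\tilde\theta_p(p)/(\hat\sigma\xi_{n,p})$ and $T^*_p=\sqrt n\,\tilde\theta_p(p)/(\sigma\xi_{n,p})$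 for $1\le p\le P$, and $$\hat p=\max\{p: 0\le p\le P,\ |T_p|\ge c_p\},\qquad \hat p^*=\max\{p: 0\le p\le P,\ |T^*_p|\ge c_p\},\qquad \tilde\theta=\tilde\theta(\hat p),\qquad \tilde\theta^*=\tilde\theta(\hat p^*)$$ (the values $c_p$ for $p<\mathcal O$ are irrelevant, since $\hat p,\hat p^*\ge\mathcal O$). For $t\in\mathbb R^k$ and $\mathcal O\le p\le P$ define, with $\le$ understood componentwise, $$G(t)=\Pr(\sqrt nA(\tilde\theta-\theta)\le t),\quad G^*(t)=\Pr(\sqrt nA(\tilde\theta^*-\theta)\le t),\quad \pi(p)=\Pr(\hat p=p),\quad \pi^*(p)=\Pr(\hat p^*=p).$$ Let $\eta_n(p)\in\mathbb R^P$ have first $p$ components $\theta[p]+(X[p]'X[p])^{-1}X[p]'X[-p]\theta[-p]$ and all other components zero, so that $\eta_n(0)=0$ and $\eta_n(P)=\theta$; $\eta_{n,q}(q)$ is the $q$-th component of $\eta_n(q)$. Let $\Sigma_p=A[p](X[p]'X[p]/n)^{-1}A[p]'$ (with $\Sigma_0=0$) and let $\Phi_{n,p}$ be the (possibly degenerate)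 Gaussian law $N(0,\sigma^2\Sigma_p)$ on $\mathbb R^k$, as well as its cdf; $\Phi_{n,0}$ is the point mass at zero. For $1\le p\le P$ let $C_n^{(p)}=A[p](X[p]'X[p]/n)^{-1}e_p$, where $e_p$ is the $p$-th standard basis vector of $\mathbb R^p$. For $\mathcal O<p\le P$ let $b_{n,p}=C_n^{(p)\prime}\Sigma_p^-$ and $\zeta_{n,p}=(\xi_{n,p}^2-b_{n,p}C_n^{(p)})^{1/2}$, where $\Sigma_p^-$ is any matrix with $\Sigma_p\Sigma_p^-\Sigma_p=\Sigma_p$. Let $\Delta_s(a,b)=\Pr(|M-a|<b)$ for $M\sim N(0,s^2)$, $s\ge0$ (with $M=0$ if $s=0$), and $$\gamma_q(s)=\Delta_{\sigma\xi_{n,q}}\big(\sqrt n\,\eta_{n,q}(q),\,s c_q\sigma\xi_{n,q}\big),\qquad \gamma^*_q(z,s)=\Delta_{\sigma\zeta_{n,q}}\big(\sqrt n\,\eta_{n,q}(q)+b_{n,q}z,\,s c_q\sigma\xi_{n,q}\big).$$ Let $h$ be the density of $(n-P)^{-1/2}$ times the square root of a chi-square variable with $m=n-P$ degrees of freedom,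 that is, $h(s)=\frac{2(m/2)^{m/2}}{\Gamma(m/2)}s^{m-1}e^{-ms^2/2}$ for $s>0$ and $h(s)=0$ otherwise. Then, for every choice of the generalized inverses $\Sigma_p^-$: 1. $\hat\sigma/\sigma$ has density $h$. 2. $\pi^*(\mathcal O)=\prod_{q=\mathcal O+1}^P\gamma_q(1)$, and $\pi^*(p)=(1-\gamma_p(1))\prod_{q=p+1}^P\gamma_q(1)$ for $\mathcal O<p\le P$. 3. $\pi(\mathcal O)=\int_0^\infty\prod_{q=\mathcal O+1}^P\gamma_q(s)\,h(s)\,ds$, and $\pi(p)=\int_0^\infty(1-\gamma_p(s))\prod_{q=p+1}^P\gamma_q(s)\,h(s)\,ds$ for $\mathcal O<p\le P$. 4. For all $t\in\mathbb R^k$, $$G^*(t)=\Phi_{n,\mathcal O}\big(t-\sqrt nA(\eta_n(\mathcal O)-\theta)\big)\prod_{q=\mathcal O+1}^P\gamma_q(1)+\sum_{p=\mathcal O+1}^P\int_{z\le t-\sqrt nA(\eta_n(p)-\theta)}(1-\gamma^*_p(z,1))\,\Phi_{n,p}(dz)\prod_{q=p+1}^P\gamma_q(1).$$ 5. For all $t\in\mathbb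 R^k$, $$G(t)=\Phi_{n,\mathcal O}\big(t-\sqrt nA(\eta_n(\mathcal O)-\theta)\big)\int_0^\infty\prod_{q=\mathcal O+1}^P\gamma_q(s)h(s)\,ds+\sum_{p=\mathcal O+1}^P\int_{z\le t-\sqrt nA(\eta_n(p)-\theta)}\Big[\int_0^\infty(1-\gamma^*_p(z,s))\prod_{q=p+1}^P\gamma_q(s)h(s)\,ds\Big]\Phi_{n,p}(dz).$$ -/

import Mathlib

open MeasureTheory ProbabilityTheory Matrix

noncomputable section

namespace PostModelSelection

variable {n P k m : ℕ}

/-! ### Matrix notation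

Regressors are numbered `1, …, P` in the mathematics and by `j : Fin P` (that is, `j + 1`) in the
code.  Model orders `p` are natural numbers. -/

/-- `D[p]`: the first `p` columns of `D`. -/
def firstCols (D : Matrix (Fin m) (Fin P) ℝ) (p : ℕ) :
    Matrix (Fin m) {j : Fin P // (j : ℕ) < p} ℝ :=
  D.submatrix id Subtype.val

/-- `D[-p]`: the last `P - p` columns of `D`. -/
def lastCols (D : Matrix (Fin m) (Fin P) ℝ) (p : ℕ) :
    Matrix (Fin m) {j : Fin P // p ≤ (j : ℕ)} ℝ :=
  D.submatrix id Subtype.val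

/-- `x[p]`: the first `p` components of `x`. -/
def head (x : Fin P → ℝ) (p : ℕ) : {j : Fin P // (j : ℕ) < p} → ℝ := fun j => x j

/-- `x[-p]`: the last `P - p` components of `x`. -/
def tail (x : Fin P → ℝ) (p : ℕ) : {j : Fin P // p ≤ (j : ℕ)} → ℝ := fun j => x j

/-- The vector of length `P` whose first `p` components are `v` and whose others are zero. -/
def padZero (p : ℕ) (v : {j : Fin P // (j : ℕ) < p} → ℝ) : Fin P → ℝ :=
  fun j => if h : (j : ℕ) < p then v ⟨j, h⟩ else 0

/-- The standard basis vector `e_p` of `ℝ^P` for `1 ≤ p ≤ P` (and the zero vector for `p = 0`). -/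
def stdVec (P p : ℕ) : Fin P → ℝ := fun j => if (j : ℕ) + 1 = p then 1 else 0

/-- The `p`-th component `x_p` of `x` for `1 ≤ p ≤ P` (and zero for `p = 0`). -/
def comp (x : Fin P → ℝ) (p : ℕ) : ℝ := stdVec P p ⬝ᵥ x

/-! ### Estimators -/

/-- `X[p]'X[p]`. -/
def gram (X : Matrix (Fin n) (Fin P) ℝ) (p : ℕ) :
    Matrix {j : Fin P // (j : ℕ) < p} {j : Fin P // (j : ℕ) < p} ℝ :=
  (firstCols X p)ᵀ * firstCols X p

/-- The restricted least-squares estimator of order `p`: its first `p` components are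
`(X[p]'X[p])⁻¹ X[p]'Y`, its last `P - p` components are zero. -/
def restrictedLS (X : Matrix (Fin n) (Fin P) ℝ) (p : ℕ) (Y : Fin n → ℝ) : Fin P → ℝ :=
  padZero p ((gram X p)⁻¹ *ᵥ ((firstCols X p)ᵀ *ᵥ Y))

/-- `σ̂ = ((n - P)⁻¹ (Y - X θ̃(P))'(Y - X θ̃(P)))^{1/2}`. -/
def sigmaHat (X : Matrix (Fin n) (Fin P) ℝ) (Y : Fin n → ℝ) : ℝ :=
  √(((n : ℝ) - P)⁻¹ *
    ((Y - X *ᵥ restrictedLS X P Y) ⬝ᵥ (Y - X *ᵥ restrictedLS X P Y)))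

/-- `(X[p]'X[p]/n)⁻¹`. -/
def invGram (X : Matrix (Fin n) (Fin P) ℝ) (p : ℕ) :
    Matrix {j : Fin P // (j : ℕ) < p} {j : Fin P // (j : ℕ) < p} ℝ :=
  ((n : ℝ)⁻¹ • gram X p)⁻¹

/-- `ξ_{n,p}`, the square root of the `p`-th diagonal entry of `(X[p]'X[p]/n)⁻¹`, for
`1 ≤ p ≤ P`. The entry is written as `e_p' (X[p]'X[p]/n)⁻¹ e_p`. -/
def xi (X : Matrix (Fin n) (Fin P) ℝ) (p : ℕ) : ℝ :=
  √(head (stdVec P p) p ⬝ᵥ (invGram X p *ᵥ head (stdVec P p) p))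

/-- The statistic `√n θ̃_p(p) / (s ξ_{n,p})` for `p > 0`, and `0` for `p = 0`. With `s = σ̂` this
is `T_p`, with `s = σ` it is `T_p^*`. -/
def testStat (X : Matrix (Fin n) (Fin P) ℝ) (s : ℝ) (p : ℕ) (Y : Fin n → ℝ) : ℝ :=
  if p = 0 then 0 else √(n : ℝ) * comp (restrictedLS X p Y) p / (s * xi X p)

/-- `max {p : |T_p| ≥ c_p, 0 ≤ p ≤ P}` with the scale `s` in the test statistics. -/
def select (X : Matrix (Fin n) (Fin P) ℝ) (c : ℕ → ℝ) (s : ℝ) (Y : Fin n → ℝ) : ℕ :=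
  Nat.findGreatest (fun p => |testStat X s p Y| ≥ c p) P

/-- The model selector `p̂`, based on the estimated error variance. -/
def pHat (X : Matrix (Fin n) (Fin P) ℝ) (c : ℕ → ℝ) (Y : Fin n → ℝ) : ℕ :=
  select X c (sigmaHat X Y) Y

/-- The idealized model selector `p̂^*`, based on the true error variance. -/
def pHatStar (X : Matrix (Fin n) (Fin P) ℝ) (c : ℕ → ℝ) (σ : ℝ) (Y : Fin n → ℝ) : ℕ :=
  select X c σ Y

/-- The post-model-selection estimator `θ̃`. -/
def postLS (X : Matrix (Fin n) (Fin P) ℝ) (c : ℕ → ℝ) (Y : Fin n → ℝ) : Fin P → ℝ :=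
  restrictedLS X (pHat X c Y) Y

/-- The idealized post-model-selection estimator `θ̃^*`. -/
def postLSStar (X : Matrix (Fin n) (Fin P) ℝ) (c : ℕ → ℝ) (σ : ℝ) (Y : Fin n → ℝ) :
    Fin P → ℝ :=
  restrictedLS X (pHatStar X c σ Y) Y

/-! ### Quantities in the finite-sample formulas -/

/-- `η_n(p)`: first `p` components `θ[p] + (X[p]'X[p])⁻¹ X[p]'X[-p]θ[-p]`, the others zero. -/
def eta (X : Matrix (Fin n) (Fin P) ℝ) (θ : Fin P → ℝ) (p : ℕ) : Fin P → ℝ :=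
  padZero p (head θ p +
    (gram X p)⁻¹ *ᵥ ((firstCols X p)ᵀ *ᵥ (lastCols X p *ᵥ tail θ p)))

/-- `A[p] (X[p]'X[p]/n)⁻¹ A[p]'`. -/
def covA (X : Matrix (Fin n) (Fin P) ℝ) (A : Matrix (Fin k) (Fin P) ℝ) (p : ℕ) :
    Matrix (Fin k) (Fin k) ℝ :=
  firstCols A p * invGram X p * (firstCols A p)ᵀ

/-- The measure `Φ_{n,p}(dz)` on `ℝ^k`: the centred Gaussian law with covariance matrix
`σ² A[p] (X[p]'X[p]/n)⁻¹ A[p]'`, which is the point mass at zero if `p = 0`. -/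
def gaussPhi (X : Matrix (Fin n) (Fin P) ℝ) (A : Matrix (Fin k) (Fin P) ℝ) (σ : ℝ) (p : ℕ) :
    Measure (Fin k → ℝ) :=
  (multivariateGaussian (0 : EuclideanSpace ℝ (Fin k)) (σ ^ 2 • covA X A p)).map
    (MeasurableEquiv.toLp 2 (Fin k → ℝ)).symm

/-- `C_n^{(p)} = A[p] (X[p]'X[p]/n)⁻¹ e_p`. -/
def covC (X : Matrix (Fin n) (Fin P) ℝ) (A : Matrix (Fin k) (Fin P) ℝ) (p : ℕ) : Fin k → ℝ :=
  firstCols A p *ᵥ (invGram X p *ᵥ head (stdVec P p) p)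

/-- `S` is a generalized inverse of `M`. -/
def IsGenInverse (M S : Matrix (Fin k) (Fin k) ℝ) : Prop := M * S * M = M

/-- The row vector `b_{n,p} = C_n^{(p)}' S`, where `S` is a generalized inverse of
`A[p] (X[p]'X[p]/n)⁻¹ A[p]'`. -/
def bVec (X : Matrix (Fin n) (Fin P) ℝ) (A : Matrix (Fin k) (Fin P) ℝ)
    (S : Matrix (Fin k) (Fin k) ℝ) (p : ℕ) : Fin k → ℝ :=
  covC X A p ᵥ* S

/-- `ζ_{n,p} = (ξ_{n,p}² - b_{n,p} C_n^{(p)})^{1/2}`. -/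
def zeta (X : Matrix (Fin n) (Fin P) ℝ) (A : Matrix (Fin k) (Fin P) ℝ)
    (S : Matrix (Fin k) (Fin k) ℝ) (p : ℕ) : ℝ :=
  √(xi X p ^ 2 - bVec X A S p ⬝ᵥ covC X A p)

/-- `Δ_s(a, b) = P(|M - a| < b)` for `M ~ N(0, s²)` (with `M = 0` if `s = 0`). -/
def Delta (s a b : ℝ) : ℝ := (gaussianReal 0 (s ^ 2).toNNReal).real {x | |x - a| < b}

/-- `γ(ξ_{n,q}, s) = Δ_{σ ξ_{n,q}}(√n η_{n,q}(q), s c_q σ ξ_{n,q})`. -/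
def gam (X : Matrix (Fin n) (Fin P) ℝ) (θ : Fin P → ℝ) (σ : ℝ) (c : ℕ → ℝ) (q : ℕ) (s : ℝ) : ℝ :=
  Delta (σ * xi X q) (√(n : ℝ) * comp (eta X θ q) q) (s * c q * σ * xi X q)

/-- `γ^*(ζ_{n,q}, z, s) = Δ_{σ ζ_{n,q}}(√n η_{n,q}(q) + b_{n,q} z, s c_q σ ξ_{n,q})`. -/
def gamStar (X : Matrix (Fin n) (Fin P) ℝ) (A : Matrix (Fin k) (Fin P) ℝ)
    (S : Matrix (Fin k) (Fin k) ℝ) (θ : Fin P → ℝ) (σ : ℝ) (c : ℕ → ℝ) (q : ℕ)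
    (z : Fin k → ℝ) (s : ℝ) : ℝ :=
  Delta (σ * zeta X A S q) (√(n : ℝ) * comp (eta X θ q) q + bVec X A S q ⬝ᵥ z)
    (s * c q * σ * xi X q)

/-- The vector `√n A (η_n(p) - θ)`. -/
def shift (X : Matrix (Fin n) (Fin P) ℝ) (A : Matrix (Fin k) (Fin P) ℝ) (θ : Fin P → ℝ) (p : ℕ) :
    Fin k → ℝ :=
  √(n : ℝ) • A *ᵥ (eta X θ p - θ)

/-- The density of `m^{-1/2}` times the square root of a chi-square variable with `m` degrees of
freedom. -/
def chiDensity (m : ℕ) (s : ℝ) : ℝ :=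
  if 0 < s then
    2 * ((m : ℝ) / 2) ^ ((m : ℝ) / 2) / Real.Gamma ((m : ℝ) / 2) * s ^ (m - 1) *
      Real.exp (-((m : ℝ) * s ^ 2 / 2))
  else 0

/-! ### Distributions of interest

Here `ν` is the underlying probability measure and `Y` is the vector of observations. -/

variable {Ω : Type*} [MeasurableSpace Ω]

/-- The cdf `G_{n,θ,σ}(t)` of `√n A (θ̃ - θ)`. -/
def cdfG (ν : Measure Ω) (Y : Ω → Fin n → ℝ) (X : Matrix (Fin n) (Fin P) ℝ)
    (A : Matrix (Fin k) (Fin P) ℝ) (θ : Fin P → ℝ) (c : ℕ → ℝ) (t : Fin k → ℝ) : ℝ :=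
  ν.real {ω | √(n : ℝ) • A *ᵥ (postLS X c (Y ω) - θ) ≤ t}

/-- The cdf `G^*_{n,θ,σ}(t)` of `√n A (θ̃^* - θ)`. -/
def cdfGStar (ν : Measure Ω) (Y : Ω → Fin n → ℝ) (X : Matrix (Fin n) (Fin P) ℝ)
    (A : Matrix (Fin k) (Fin P) ℝ) (θ : Fin P → ℝ) (σ : ℝ) (c : ℕ → ℝ) (t : Fin k → ℝ) : ℝ :=
  ν.real {ω | √(n : ℝ) • A *ᵥ (postLSStar X c σ (Y ω) - θ) ≤ t}

/-- The model selection probability `π_{n,θ,σ}(p)`. -/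
def selProb (ν : Measure Ω) (Y : Ω → Fin n → ℝ) (X : Matrix (Fin n) (Fin P) ℝ) (c : ℕ → ℝ)
    (p : ℕ) : ℝ :=
  ν.real {ω | pHat X c (Y ω) = p}

/-- The idealized model selection probability `π^*_{n,θ,σ}(p)`. -/
def selProbStar (ν : Measure Ω) (Y : Ω → Fin n → ℝ) (X : Matrix (Fin n) (Fin P) ℝ) (σ : ℝ)
    (c : ℕ → ℝ) (p : ℕ) : ℝ :=
  ν.real {ω | pHatStar X c σ (Y ω) = p}

end PostModelSelection

end

/-! Every statistic is built from linear images of the Gaussian error `u`, and orthogonality of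
these images does the work. Restricted least squares sends `Xθ` to `η_n(p)`. So `√n θ̃_q(q)` is `√n
η_{n,q}(q) + a_q'u` with `a_q = coefRow X q`, and `√n A(θ̃(p) - θ)` is a constant plus `L_p u` with
`L_p = estMat X A p`. The vector `a_q` lies in the span of the first `q` columns and is orthogonal
to the earlier ones. Hence the `a_q` are mutually orthogonal, `L_p a_q = 0` for `q > p`, and
everything is orthogonal to the residual of the full regression (`residMat`).

Order `p` is selected when `|T_p| ≥ c_p` and `|T_q| < c_q` for all `q > p`. Among these statistics
only `a_p'u` can be correlated with `L_p u`. Subtracting its regression `b_{n,p} L_p u` leaves the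
inner product of `u` with `condRow X A S p`, a vector orthogonal to the rows of `L_p` and of squared
length `ζ_{n,p}²`. So `L_p u`, the scale, this remainder and the later `a_q'u` are independent, and
Fubini yields an integral of a product (`measureReal_select_eq`). At the minimal order `c_O = 0`
makes the first condition void (`measureReal_select_eq_min`).

Known and unknown variance are one case: the scale is `σ` times a function `f` of the residuals,
either `f = 1` or `f = σ̂/σ`, and the formulas integrate over the law of `f`, a point mass at `1` or
the density `h`. The cdf is a sum over the selected order; the selection probabilities are the case
of an `A` without rows. The density `h` comes from orthonormal coordinates on the orthogonal
complement of the column space, followed by polar coordinates. -/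

noncomputable section

namespace PostModelSelection

/-! ### Linear images of an iid Gaussian vector -/

section GaussianVectors

variable {ι κ κ' : Type*} [Fintype ι] [Fintype κ] [Fintype κ']

/-- The law of a vector of independent centred Gaussian variables with variance `v`. -/
abbrev iidGaussian (ι : Type*) [Fintype ι] (v : NNReal) : Measure (ι → ℝ) :=
  Measure.pi fun _ => gaussianReal 0 v

lemma measurable_mulVec (L : Matrix κ ι ℝ) : Measurable fun x : ι → ℝ => L *ᵥ x :=
  (Continuous.matrix_mulVec continuous_const continuous_id).measurable

lemma measurable_dotProduct (a : ι → ℝ) : Measurable fun x : ι → ℝ => a ⬝ᵥ x :=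
  (Continuous.dotProduct continuous_const continuous_id).measurable

/-- Characteristic functions: at `t` the image has the value of the product law at `L't`, and
`|L't|² = t'LL't`. No rank condition on `L` is needed, so degenerate laws are covered. -/
lemma map_mulVec_iidGaussian [DecidableEq κ] (v : NNReal) (L : Matrix κ ι ℝ) :
    (iidGaussian ι v).map (fun x => L *ᵥ x) =
      (multivariateGaussian (0 : EuclideanSpace ℝ κ) ((v : ℝ) • (L * Lᵀ))).map
        (MeasurableEquiv.toLp 2 (κ → ℝ)).symm := by
  have hS : ((v : ℝ) • (L * Lᵀ)).PosSemidef := by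
    have := Matrix.posSemidef_self_mul_conjTranspose L
    rw [conjTranspose_eq_transpose_of_trivial] at this
    exact this.smul v.2
  suffices h : ((iidGaussian ι v).map (fun x => L *ᵥ x)).map (MeasurableEquiv.toLp 2 (κ → ℝ)) =
      multivariateGaussian (0 : EuclideanSpace ℝ κ) ((v : ℝ) • (L * Lᵀ)) by
    rw [← h, Measure.map_map (by fun_prop) (by fun_prop)]
    simp
  rw [Measure.map_map (by fun_prop) (measurable_mulVec L)]
  have : IsProbabilityMeasure ((iidGaussian ι v).map
      (MeasurableEquiv.toLp 2 (κ → ℝ) ∘ fun x => L *ᵥ x)) :=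
    Measure.isProbabilityMeasure_map
      ((MeasurableEquiv.toLp 2 (κ → ℝ)).measurable.comp (measurable_mulVec L)).aemeasurable
  apply Measure.ext_of_charFun (E := EuclideanSpace ℝ κ)
  ext t
  rw [charFun_multivariateGaussian hS]
  have h1 : charFun ((iidGaussian ι v).map
      (MeasurableEquiv.toLp 2 (κ → ℝ) ∘ fun x => L *ᵥ x)) t =
      charFun ((iidGaussian ι v).map (WithLp.toLp 2)) (WithLp.toLp 2 (t.ofLp ᵥ* L)) := by
    rw [charFun_apply, charFun_apply, integral_map, integral_map]
    · congr with x
      simp only [Function.comp, MeasurableEquiv.toLp_apply, EuclideanSpace.inner_eq_star_dotProduct,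
        star_trivial]
      rw [Matrix.dotProduct_mulVec]
    · fun_prop
    · exact Measurable.aestronglyMeasurable (by fun_prop)
    · exact ((MeasurableEquiv.toLp 2 (κ → ℝ)).measurable.comp (measurable_mulVec L)).aemeasurable
    · exact Measurable.aestronglyMeasurable (by fun_prop)
  rw [h1, charFun_pi]
  simp only [charFun_gaussianReal, ← Complex.exp_sum]
  congr 1
  simp only [inner_zero_right, Complex.ofReal_zero, mul_zero, zero_mul, zero_sub,
    Finset.sum_neg_distrib, ← Finset.sum_div, ← Finset.mul_sum]
  congr 2
  have : t.ofLp ⬝ᵥ ((v : ℝ) • (L * Lᵀ)) *ᵥ t.ofLp = v * ∑ i, (t.ofLp ᵥ* L) i ^ 2 := by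
    rw [smul_mulVec, dotProduct_smul, ← mulVec_mulVec, dotProduct_mulVec, mulVec_transpose,
      smul_eq_mul, dotProduct]
    simp [sq]
  rw [this]
  push_cast
  rfl

lemma iIndepFun_eval_iidGaussian (v : NNReal) :
    iIndepFun (fun i (x : ι → ℝ) => x i) (iidGaussian ι v) :=
  iIndepFun_pi (X := fun _ x => x) fun _ => aemeasurable_id

lemma map_eval_iidGaussian (v : NNReal) (i : ι) :
    (iidGaussian ι v).map (fun x => x i) = gaussianReal 0 v :=
  (measurePreserving_eval _ i).map_eq

lemma hasGaussianLaw_eval_iidGaussian (v : NNReal) (i : ι) :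
    HasGaussianLaw (fun x : ι → ℝ => x i) (iidGaussian ι v) where
  isGaussian_map := by rw [map_eval_iidGaussian]; infer_instance

lemma hasGaussianLaw_id_iidGaussian (v : NNReal) :
    HasGaussianLaw (fun x : ι → ℝ => x) (iidGaussian ι v) :=
  (iIndepFun_eval_iidGaussian v).hasGaussianLaw (hasGaussianLaw_eval_iidGaussian v)

lemma hasGaussianLaw_mulVec (v : NNReal) (L : Matrix κ ι ℝ) :
    HasGaussianLaw (fun x => L *ᵥ x) (iidGaussian ι v) :=
  (hasGaussianLaw_id_iidGaussian v).map_fun (Matrix.mulVecLin L).toContinuousLinearMap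

lemma covariance_dotProduct_iidGaussian (v : NNReal) (a b : ι → ℝ) :
    cov[fun x => a ⬝ᵥ x, fun x => b ⬝ᵥ x; iidGaussian ι v] = v * (a ⬝ᵥ b) := by
  classical
  have hm (i : ι) : MemLp (fun x : ι → ℝ => x i) 2 (iidGaussian ι v) :=
    (hasGaussianLaw_eval_iidGaussian v i).memLp_two
  have hc (i j : ι) : cov[fun x : ι → ℝ => x i, fun x => x j; iidGaussian ι v] =
      if i = j then (v : ℝ) else 0 := by
    split_ifs with h
    · subst h
      rw [covariance_self (measurable_pi_apply i).aemeasurable,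
        ← variance_id_map (measurable_pi_apply i).aemeasurable, map_eval_iidGaussian,
        variance_id_gaussianReal]
    · exact ((iIndepFun_eval_iidGaussian v).indepFun h).covariance_eq_zero (hm i) (hm j)
  simp only [dotProduct]
  rw [covariance_fun_sum_fun_sum (fun i => (hm i).const_mul _) (fun i => (hm i).const_mul _)]
  simp [covariance_const_mul_left, covariance_const_mul_right, hc, Finset.mul_sum]
  exact Finset.sum_congr rfl fun i _ => by ring

lemma map_dotProduct_iidGaussian (v : NNReal) (a : ι → ℝ) :
    (iidGaussian ι v).map (fun x => a ⬝ᵥ x) = gaussianReal 0 (v * (a ⬝ᵥ a)).toNNReal := by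
  have h : HasGaussianLaw (fun x => a ⬝ᵥ x) (iidGaussian ι v) :=
    (hasGaussianLaw_mulVec v (Matrix.of fun _ : Unit => a)).map_fun (.proj ())
  rw [h.map_eq_gaussianReal, ← covariance_self (measurable_dotProduct a).aemeasurable,
    covariance_dotProduct_iidGaussian]
  congr 1
  simp only [dotProduct]
  rw [integral_finsetSum _ fun i _ =>
    ((hasGaussianLaw_eval_iidGaussian v i).integrable.const_mul _)]
  refine Finset.sum_eq_zero fun i _ => ?_
  have := integral_map (μ := iidGaussian ι v) (φ := fun x => x i) (f := id)
    (measurable_pi_apply i).aemeasurable (by fun_prop)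
  rw [map_eval_iidGaussian] at this
  rw [integral_const_mul]
  simp only [id_eq, integral_id_gaussianReal] at this
  rw [← this, mul_zero]

/-- The two images are jointly Gaussian, so independence reduces to vanishing cross-covariances,
which are the entries of `v L K'`. -/
lemma indepFun_mulVec_iidGaussian (v : NNReal) {L : Matrix κ ι ℝ} {K : Matrix κ' ι ℝ}
    (h : L * Kᵀ = 0) :
    IndepFun (fun x => L *ᵥ x) (fun x => K *ᵥ x) (iidGaussian ι v) := by
  refine HasGaussianLaw.indepFun_of_covariance_eval (X := fun i x => (L *ᵥ x) i)
    (Y := fun j x => (K *ᵥ x) j) ?_ fun i j => ?_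
  · exact (hasGaussianLaw_id_iidGaussian v).map_fun
      ((Matrix.mulVecLin L).toContinuousLinearMap.prod (Matrix.mulVecLin K).toContinuousLinearMap)
  · refine (covariance_dotProduct_iidGaussian v (L i) (K j)).trans ?_
    rw [show L i ⬝ᵥ K j = (L * Kᵀ) i j from rfl, h]
    simp

lemma map_mulVec_iidGaussian_of_orthogonal (v : NNReal) {L : Matrix κ ι ℝ}
    (h : ∀ i j, i ≠ j → L i ⬝ᵥ L j = 0) :
    (iidGaussian ι v).map (fun x => L *ᵥ x) =
      Measure.pi fun j => gaussianReal 0 (v * (L j ⬝ᵥ L j)).toNNReal := by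
  have hi : iIndepFun (fun j (x : ι → ℝ) => L j ⬝ᵥ x) (iidGaussian ι v) := by
    refine HasGaussianLaw.iIndepFun_of_covariance_eq_zero (hasGaussianLaw_mulVec v L)
      fun i j hij => ?_
    rw [covariance_dotProduct_iidGaussian, h i j hij, mul_zero]
  rw [iIndepFun_iff_map_fun_eq_pi_map fun j => (measurable_dotProduct (L j)).aemeasurable] at hi
  simp_rw [map_dotProduct_iidGaussian] at hi
  exact hi

/-- The joint law of `L x`, `f (K x)` and `G x` for mutually orthogonal `L`, `K` and rows of `G`. -/
lemma map_prod_mulVec_iidGaussian {κ'' : Type*} [Fintype κ''] (v : NNReal) {L : Matrix κ ι ℝ}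
    {K : Matrix κ' ι ℝ} {G : Matrix κ'' ι ℝ} (hLK : L * Kᵀ = 0) (hLG : L * Gᵀ = 0)
    (hKG : K * Gᵀ = 0) (hG : ∀ i j, i ≠ j → G i ⬝ᵥ G j = 0) {f : (κ' → ℝ) → ℝ}
    (hf : Measurable f) :
    (iidGaussian ι v).map (fun x => (L *ᵥ x, f (K *ᵥ x), G *ᵥ x)) =
      ((iidGaussian ι v).map (fun x => L *ᵥ x)).prod
        (((iidGaussian ι v).map (fun x => f (K *ᵥ x))).prod
          (Measure.pi fun j => gaussianReal 0 (v * (G j ⬝ᵥ G j)).toNNReal)) := by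
  have hfK : Measurable fun x => f (K *ᵥ x) := hf.comp (measurable_mulVec K)
  have h1 : IndepFun (fun x => L *ᵥ x) (fun x => (f (K *ᵥ x), G *ᵥ x)) (iidGaussian ι v) := by
    -- Pairwise independence would not suffice: stacking `K` on `G` makes `L x` independent of the
    -- pair.
    have := indepFun_mulVec_iidGaussian v (L := L) (K := Matrix.fromRows K G) (by
      rw [transpose_fromRows, mul_fromCols, hLK, hLG]; ext i (j | j) <;> rfl)
    refine this.comp (φ := id) (ψ := fun y => (f fun j => y (Sum.inl j), fun j => y (Sum.inr j)))
      measurable_id ?_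
    exact (hf.comp (by fun_prop)).prodMk (by fun_prop)
  have h2 : IndepFun (fun x => f (K *ᵥ x)) (fun x => G *ᵥ x) (iidGaussian ι v) :=
    (indepFun_mulVec_iidGaussian v hKG).comp hf measurable_id
  rw [(indepFun_iff_map_prod_eq_prod_map_map (measurable_mulVec L).aemeasurable
      (hfK.prodMk (measurable_mulVec G)).aemeasurable).1 h1,
    (indepFun_iff_map_prod_eq_prod_map_map hfK.aemeasurable (measurable_mulVec G).aemeasurable).1
      h2, map_mulVec_iidGaussian_of_orthogonal v hG]

/-! ### Fubini for sections that are boxes -/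

lemma measureReal_prod_eq_integral {α β : Type*} [MeasurableSpace α] [MeasurableSpace β]
    (μ : Measure α) (μ' : Measure β) [IsProbabilityMeasure μ] [IsProbabilityMeasure μ']
    {s : Set (α × β)} (hs : MeasurableSet s) :
    (μ.prod μ').real s = ∫ x, μ'.real (Prod.mk x ⁻¹' s) ∂μ := by
  rw [measureReal_def, Measure.prod_apply hs]
  simp only [measureReal_def]
  rw [integral_toReal (measurable_measure_prodMk_left hs).aemeasurable
    (Filter.Eventually.of_forall fun x => measure_lt_top _ _)]

lemma measurableSet_prod_forall {E J : Type*} [MeasurableSpace E] [Fintype J] {B : Set E}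
    (hB : MeasurableSet B) {D : J → Set ((E × ℝ) × ℝ)} (hD : ∀ j, MeasurableSet (D j)) :
    MeasurableSet {w : E × ℝ × (J → ℝ) | w.1 ∈ B ∧ ∀ j, ((w.1, w.2.1), w.2.2 j) ∈ D j} := by
  have hm : MeasurableSet {w : E × ℝ × (J → ℝ) | ∀ j, ((w.1, w.2.1), w.2.2 j) ∈ D j} := by
    rw [Set.ofPred_forall]
    exact MeasurableSet.iInter fun j => (hD j).preimage (by fun_prop)
  exact (hB.preimage measurable_fst).inter hm

/-- For fixed `z` and `s` the condition on the remaining coordinates is a box, whose product measure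
factors. -/
lemma measureReal_prod_prod_pi {E J : Type*} [MeasurableSpace E] [Fintype J] (Φ : Measure E)
    (ρ : Measure ℝ) (κ : J → Measure ℝ) [IsProbabilityMeasure Φ] [IsProbabilityMeasure ρ]
    [∀ j, IsProbabilityMeasure (κ j)] {B : Set E} (hB : MeasurableSet B)
    {D : J → Set ((E × ℝ) × ℝ)} (hD : ∀ j, MeasurableSet (D j)) :
    (Φ.prod (ρ.prod (Measure.pi κ))).real
        {w | w.1 ∈ B ∧ ∀ j, ((w.1, w.2.1), w.2.2 j) ∈ D j} =
      ∫ z in B, ∫ s, ∏ j, (κ j).real {x | ((z, s), x) ∈ D j} ∂ρ ∂Φ := by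
  have hm1 := measurableSet_prod_forall hB hD
  rw [measureReal_prod_eq_integral _ _ hm1, ← integral_indicator hB]
  congr with z
  by_cases hz : z ∈ B
  · rw [Set.indicator_of_mem hz, measureReal_prod_eq_integral _ _ (measurable_prodMk_left hm1)]
    congr with s
    rw [show Prod.mk s ⁻¹' (Prod.mk z ⁻¹' {w : E × ℝ × (J → ℝ) |
      w.1 ∈ B ∧ ∀ j, ((w.1, w.2.1), w.2.2 j) ∈ D j}) =
        Set.univ.pi fun j => {x | ((z, s), x) ∈ D j} by ext; simp [hz]]
    simp [measureReal_def, Measure.pi_pi]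
  · rw [Set.indicator_of_notMem hz]
    simp [hz]

end GaussianVectors

variable {n P k m : ℕ}

/-! ### Least squares and its orthogonality relations -/

section LinearAlgebra

lemma dotProduct_padZero (a : Fin P → ℝ) (p : ℕ) (v : {j : Fin P // (j : ℕ) < p} → ℝ) :
    a ⬝ᵥ padZero p v = head a p ⬝ᵥ v := by
  simp only [dotProduct, padZero, head, mul_dite, mul_zero]
  rw [Finset.sum_dite, Finset.sum_const_zero, add_zero, Finset.univ_eq_attach]
  exact Fintype.sum_equiv (Equiv.subtypeEquivRight fun j => by simp)
    _ _ (fun j => rfl)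

lemma mulVec_padZero (D : Matrix (Fin m) (Fin P) ℝ) (p : ℕ)
    (v : {j : Fin P // (j : ℕ) < p} → ℝ) : D *ᵥ padZero p v = firstCols D p *ᵥ v := by
  ext i
  exact dotProduct_padZero (D i) p v

lemma padZero_add (p : ℕ) (v w : {j : Fin P // (j : ℕ) < p} → ℝ) :
    padZero p (v + w) = padZero p v + padZero p w := by
  ext j
  simp only [padZero, Pi.add_apply]
  split_ifs <;> simp

lemma firstCols_mulVec_head_add (D : Matrix (Fin m) (Fin P) ℝ) (x : Fin P → ℝ) (p : ℕ) :
    firstCols D p *ᵥ head x p + lastCols D p *ᵥ tail x p = D *ᵥ x := by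
  ext i
  simp only [Pi.add_apply, mulVec, dotProduct, firstCols, lastCols, head, tail, submatrix_apply,
    id]
  rw [← Fintype.sum_subtype_add_sum_subtype (fun j : Fin P => (j : ℕ) < p)]
  congr 1
  exact Fintype.sum_equiv (Equiv.subtypeEquivRight fun j => by simp) _ _ (fun j => rfl)

lemma restrictedLS_add (X : Matrix (Fin n) (Fin P) ℝ) (p : ℕ) (y z : Fin n → ℝ) :
    restrictedLS X p (y + z) = restrictedLS X p y + restrictedLS X p z := by
  simp only [restrictedLS, mulVec_add, padZero_add]

variable {X : Matrix (Fin n) (Fin P) ℝ}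

lemma mulVec_injective_of_rank_eq (hX : X.rank = P) : Function.Injective X.mulVec := by
  rw [← Matrix.coe_mulVecLin, ← LinearMap.ker_eq_bot]
  have h := LinearMap.finrank_range_add_finrank_ker X.mulVecLin
  rw [Module.finrank_fin_fun] at h
  have h' : Module.finrank ℝ (LinearMap.range X.mulVecLin) = P := hX
  exact Submodule.finrank_eq_zero.1 (by omega)

lemma firstCols_mulVec_injective (hX : X.rank = P) (p : ℕ) :
    Function.Injective (firstCols X p).mulVec := by
  intro v w h
  have h1 : padZero p v = padZero p w := mulVec_injective_of_rank_eq hX (by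
    simpa only [mulVec_padZero] using h)
  ext j
  have := congrFun h1 j
  simpa [padZero, j.2] using this

lemma gram_posDef (hX : X.rank = P) (p : ℕ) : (gram X p).PosDef := by
  have := Matrix.PosDef.conjTranspose_mul_self (firstCols X p) (firstCols_mulVec_injective hX p)
  rwa [conjTranspose_eq_transpose_of_trivial] at this

lemma isUnit_det_gram (hX : X.rank = P) (p : ℕ) : IsUnit (gram X p).det :=
  (Matrix.isUnit_iff_isUnit_det _).1 (gram_posDef hX p).isUnit

lemma transpose_gram (X : Matrix (Fin n) (Fin P) ℝ) (p : ℕ) : (gram X p)ᵀ = gram X p := by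
  simp [gram]

lemma transpose_inv_gram (X : Matrix (Fin n) (Fin P) ℝ) (p : ℕ) :
    ((gram X p)⁻¹)ᵀ = (gram X p)⁻¹ := by
  rw [transpose_nonsing_inv, transpose_gram]

lemma invGram_eq (hn : n ≠ 0) (hX : X.rank = P) (p : ℕ) :
    invGram X p = (n : ℝ) • (gram X p)⁻¹ := by
  have hn' : (n : ℝ) ≠ 0 := by exact_mod_cast hn
  rw [invGram]
  refine Matrix.inv_eq_left_inv ?_
  rw [smul_mul_smul_comm, nonsing_inv_mul _ (isUnit_det_gram hX p), mul_inv_cancel₀ hn', one_smul]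

/-- Identifies `η_n(p)` as the mean of the order-`p` estimator: split `Xθ` into `X[p]θ[p] +
X[-p]θ[-p]` and cancel the Gram matrix on the first term. -/
lemma restrictedLS_mulVec (hX : X.rank = P) (θ : Fin P → ℝ) (p : ℕ) :
    restrictedLS X p (X *ᵥ θ) = eta X θ p := by
  rw [restrictedLS, eta, ← firstCols_mulVec_head_add X θ p, mulVec_add, mulVec_add]
  congr 2
  rw [mulVec_mulVec, mulVec_mulVec, Matrix.mul_assoc]
  change ((gram X p)⁻¹ * gram X p) *ᵥ _ = _
  rw [nonsing_inv_mul _ (isUnit_det_gram hX p), one_mulVec]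

/-- The vector `√n X[p] (X[p]'X[p])⁻¹ e_p`, whose inner product with `u` is the centred version of
`√n θ̃_p(p)`. -/
def coefRow (X : Matrix (Fin n) (Fin P) ℝ) (p : ℕ) : Fin n → ℝ :=
  √(n : ℝ) • firstCols X p *ᵥ ((gram X p)⁻¹ *ᵥ head (stdVec P p) p)

/-- The matrix `√n A[p] (X[p]'X[p])⁻¹ X[p]'`. -/
def estMat (X : Matrix (Fin n) (Fin P) ℝ) (A : Matrix (Fin k) (Fin P) ℝ) (p : ℕ) :
    Matrix (Fin k) (Fin n) ℝ :=
  √(n : ℝ) • (firstCols A p * ((gram X p)⁻¹ * (firstCols X p)ᵀ))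

/-- The orthogonal projection on the orthogonal complement of the column space of `X`. -/
def residMat (X : Matrix (Fin n) (Fin P) ℝ) : Matrix (Fin n) (Fin n) ℝ :=
  1 - firstCols X P * ((gram X P)⁻¹ * (firstCols X P)ᵀ)

lemma comp_restrictedLS (X : Matrix (Fin n) (Fin P) ℝ) (p : ℕ) (y : Fin n → ℝ) :
    √(n : ℝ) * comp (restrictedLS X p y) p = coefRow X p ⬝ᵥ y := by
  rw [comp, restrictedLS, dotProduct_padZero, coefRow, smul_dotProduct, smul_eq_mul]
  congr 1
  rw [dotProduct_mulVec, dotProduct_mulVec, vecMul_transpose, ← mulVec_transpose,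
    transpose_inv_gram]

lemma comp_restrictedLS_add (hX : X.rank = P) (θ : Fin P → ℝ) (p : ℕ) (u : Fin n → ℝ) :
    √(n : ℝ) * comp (restrictedLS X p (X *ᵥ θ + u)) p =
      √(n : ℝ) * comp (eta X θ p) p + coefRow X p ⬝ᵥ u := by
  rw [restrictedLS_add, restrictedLS_mulVec hX, ← comp_restrictedLS, comp, comp, comp,
    dotProduct_add, mul_add]

lemma mulVec_restrictedLS_add (hX : X.rank = P) (A : Matrix (Fin k) (Fin P) ℝ) (θ : Fin P → ℝ)
    (p : ℕ) (u : Fin n → ℝ) :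
    √(n : ℝ) • A *ᵥ (restrictedLS X p (X *ᵥ θ + u) - θ) = estMat X A p *ᵥ u + shift X A θ p := by
  rw [restrictedLS_add, restrictedLS_mulVec hX, shift, add_sub_right_comm, mulVec_add, smul_add,
    add_comm, restrictedLS, mulVec_padZero, estMat, smul_mulVec, mulVec_mulVec, mulVec_mulVec,
    Matrix.mul_assoc]

lemma transpose_firstCols_mulVec_coefRow (hX : X.rank = P) (p : ℕ) :
    (firstCols X p)ᵀ *ᵥ coefRow X p = √(n : ℝ) • head (stdVec P p) p := by
  rw [coefRow, mulVec_smul, mulVec_mulVec, mulVec_mulVec]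
  change _ • (gram X p * (gram X p)⁻¹) *ᵥ _ = _
  rw [mul_nonsing_inv _ (isUnit_det_gram hX p), one_mulVec]

lemma transpose_firstCols_mulVec_coefRow_of_lt (hX : X.rank = P) {p q : ℕ} (hpq : p < q) :
    (firstCols X p)ᵀ *ᵥ coefRow X q = 0 := by
  ext ⟨j, hj⟩
  -- The normal equations give `√n e_q` on the first `q` columns, and `e_q` vanishes on the first `p
  -- < q` coordinates.
  have h := congrFun (transpose_firstCols_mulVec_coefRow hX q) ⟨j, hj.trans hpq⟩
  refine h.trans ?_
  simp only [Pi.smul_apply, head, stdVec, Pi.zero_apply]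
  rw [if_neg (by omega), smul_zero]

lemma coefRow_dotProduct_of_transpose_mulVec_eq_zero {p : ℕ} {y : Fin n → ℝ}
    (h : (firstCols X p)ᵀ *ᵥ y = 0) : coefRow X p ⬝ᵥ y = 0 := by
  rw [← comp_restrictedLS, restrictedLS, h, mulVec_zero, comp, dotProduct_padZero, dotProduct_zero,
    mul_zero]

/-- This is Gram–Schmidt: for `1 ≤ q ≤ P`, `coefRow X q` is a multiple of the part of column `q`
orthogonal to the preceding columns. -/
lemma coefRow_dotProduct_coefRow (hX : X.rank = P) {p q : ℕ} (hpq : p ≠ q) :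
    coefRow X p ⬝ᵥ coefRow X q = 0 := by
  rcases hpq.lt_or_gt with h | h
  · exact coefRow_dotProduct_of_transpose_mulVec_eq_zero
      (transpose_firstCols_mulVec_coefRow_of_lt hX h)
  · rw [dotProduct_comm]
    exact coefRow_dotProduct_of_transpose_mulVec_eq_zero
      (transpose_firstCols_mulVec_coefRow_of_lt hX h)

lemma estMat_mulVec_coefRow_of_lt (hX : X.rank = P) (A : Matrix (Fin k) (Fin P) ℝ) {p q : ℕ}
    (hpq : p < q) : estMat X A p *ᵥ coefRow X q = 0 := by
  rw [estMat, smul_mulVec, ← mulVec_mulVec, ← mulVec_mulVec,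
    transpose_firstCols_mulVec_coefRow_of_lt hX hpq, mulVec_zero, mulVec_zero, smul_zero]

lemma estMat_mulVec_coefRow (hn : n ≠ 0) (hX : X.rank = P) (A : Matrix (Fin k) (Fin P) ℝ)
    (p : ℕ) : estMat X A p *ᵥ coefRow X p = covC X A p := by
  rw [estMat, smul_mulVec, ← mulVec_mulVec, ← mulVec_mulVec, transpose_firstCols_mulVec_coefRow hX,
    covC, invGram_eq hn hX, mulVec_smul, mulVec_smul, smul_smul,
    Real.mul_self_sqrt (Nat.cast_nonneg n), smul_mulVec, mulVec_smul]

lemma estMat_mul_transpose (hn : n ≠ 0) (hX : X.rank = P) (A : Matrix (Fin k) (Fin P) ℝ)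
    (p : ℕ) : estMat X A p * (estMat X A p)ᵀ = covA X A p := by
  rw [estMat, transpose_smul, Matrix.smul_mul, Matrix.mul_smul, smul_smul,
    Real.mul_self_sqrt (Nat.cast_nonneg n), covA,
    invGram_eq hn hX, transpose_mul, transpose_mul, transpose_transpose, transpose_inv_gram]
  simp only [Matrix.mul_smul, Matrix.smul_mul]
  congr 1
  rw [← Matrix.mul_assoc, ← Matrix.mul_assoc]
  congr 1
  simp only [Matrix.mul_assoc]
  congr 1
  rw [← Matrix.mul_assoc (firstCols X p)ᵀ]
  change _ * (gram X p * _) = _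
  rw [mul_nonsing_inv _ (isUnit_det_gram hX p), Matrix.mul_one]

lemma xi_sq (hn : n ≠ 0) (hX : X.rank = P) (p : ℕ) :
    xi X p ^ 2 = coefRow X p ⬝ᵥ coefRow X p := by
  have h : coefRow X p ⬝ᵥ coefRow X p =
      head (stdVec P p) p ⬝ᵥ (invGram X p *ᵥ head (stdVec P p) p) := by
    conv_lhs =>
      arg 2
      rw [coefRow]
    rw [dotProduct_smul, dotProduct_mulVec, ← mulVec_transpose,
      transpose_firstCols_mulVec_coefRow hX, invGram_eq hn hX, smul_dotProduct, smul_smul,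
      smul_eq_mul, smul_mulVec, dotProduct_smul,
      Real.mul_self_sqrt (Nat.cast_nonneg n), smul_eq_mul]
  rw [h, xi, Real.sq_sqrt]
  rw [← h]
  exact Finset.sum_nonneg fun i _ => mul_self_nonneg _

lemma xi_pos (hn : n ≠ 0) (hX : X.rank = P) {p : ℕ} (hp : 0 < p) (hpP : p ≤ P) : 0 < xi X p := by
  refine (Real.sqrt_nonneg _).lt_of_ne' fun h => ?_
  have h0 := xi_sq hn hX p
  rw [show xi X p = 0 from h, zero_pow two_ne_zero, eq_comm, dotProduct_self_eq_zero] at h0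
  -- Regressor `p` has zero-based index `p - 1`; there the normal equations would read `0 = √n`.
  have h1 := congrFun (transpose_firstCols_mulVec_coefRow hX p) ⟨⟨p - 1, by omega⟩, by
    simp only; omega⟩
  rw [h0, mulVec_zero] at h1
  simp only [Pi.zero_apply, Pi.smul_apply, head, stdVec, smul_eq_mul] at h1
  rw [if_pos (by omega), mul_one] at h1
  have : (0 : ℝ) < √(n : ℝ) := Real.sqrt_pos.2 (by exact_mod_cast Nat.pos_of_ne_zero hn)
  exact this.ne h1

/-! ### The residual projection -/

lemma residMat_mul_firstCols_top (hX : X.rank = P) : residMat X * firstCols X P = 0 := by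
  rw [residMat, Matrix.sub_mul, Matrix.one_mul, Matrix.mul_assoc, Matrix.mul_assoc]
  change _ - firstCols X P * (_ * gram X P) = 0
  rw [nonsing_inv_mul _ (isUnit_det_gram hX P), Matrix.mul_one, sub_self]

lemma residMat_mul_firstCols (hX : X.rank = P) (p : ℕ) : residMat X * firstCols X p = 0 := by
  ext i j
  exact congrFun (congrFun (residMat_mul_firstCols_top hX) i) ⟨j, j.1.2⟩

lemma residMat_mul_self (hX : X.rank = P) : residMat X * X = 0 := by
  ext i j
  exact congrFun (congrFun (residMat_mul_firstCols_top hX) i) ⟨j, j.2⟩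

lemma transpose_residMat (X : Matrix (Fin n) (Fin P) ℝ) : (residMat X)ᵀ = residMat X := by
  rw [residMat, transpose_sub, transpose_one, transpose_mul, transpose_mul, transpose_inv_gram,
    transpose_transpose, Matrix.mul_assoc]

lemma residMat_mulVec_coefRow (hX : X.rank = P) (p : ℕ) : residMat X *ᵥ coefRow X p = 0 := by
  rw [coefRow, mulVec_smul, mulVec_mulVec, residMat_mul_firstCols hX, zero_mulVec, smul_zero]

lemma estMat_mul_residMat (hX : X.rank = P) (A : Matrix (Fin k) (Fin P) ℝ) (p : ℕ) :
    estMat X A p * (residMat X)ᵀ = 0 := by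
  have h : (firstCols X p)ᵀ * (residMat X)ᵀ = 0 := by
    rw [← transpose_mul, residMat_mul_firstCols hX, transpose_zero]
  rw [estMat, Matrix.smul_mul, Matrix.mul_assoc, Matrix.mul_assoc, h, Matrix.mul_zero,
    Matrix.mul_zero, smul_zero]

lemma sub_mulVec_restrictedLS (hX : X.rank = P) (θ : Fin P → ℝ) (u : Fin n → ℝ) :
    X *ᵥ θ + u - X *ᵥ restrictedLS X P (X *ᵥ θ + u) = residMat X *ᵥ u := by
  have h (y : Fin n → ℝ) : y - X *ᵥ restrictedLS X P y = residMat X *ᵥ y := by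
    rw [restrictedLS, mulVec_padZero, residMat, sub_mulVec, one_mulVec, mulVec_mulVec,
      mulVec_mulVec, Matrix.mul_assoc]
  rw [h, mulVec_add, mulVec_mulVec, residMat_mul_self hX, zero_mulVec, zero_add]

lemma sigmaHat_eq (hX : X.rank = P) (θ : Fin P → ℝ) (u : Fin n → ℝ) :
    sigmaHat X (X *ᵥ θ + u) =
      √(((n : ℝ) - P)⁻¹ * ((residMat X *ᵥ u) ⬝ᵥ (residMat X *ᵥ u))) := by
  rw [sigmaHat, sub_mulVec_restrictedLS hX]

/-- The residual of `coefRow X p` in the regression on the rows of `estMat X A p`. -/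
def condRow (X : Matrix (Fin n) (Fin P) ℝ) (A : Matrix (Fin k) (Fin P) ℝ)
    (S : Matrix (Fin k) (Fin k) ℝ) (p : ℕ) : Fin n → ℝ :=
  coefRow X p - bVec X A S p ᵥ* estMat X A p

/-- Splits the `p`-th statistic into the part predicted by the estimator and a remainder, which is
independent of the estimator once `S` is a generalized inverse. -/
lemma coefRow_dotProduct_eq (X : Matrix (Fin n) (Fin P) ℝ) (A : Matrix (Fin k) (Fin P) ℝ)
    (S : Matrix (Fin k) (Fin k) ℝ) (p : ℕ) (u : Fin n → ℝ) :
    coefRow X p ⬝ᵥ u = bVec X A S p ⬝ᵥ (estMat X A p *ᵥ u) + condRow X A S p ⬝ᵥ u := by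
  rw [condRow, sub_dotProduct, dotProduct_mulVec, add_sub_cancel]

/-- `C_n^{(p)}` is `L` applied to `coefRow X p`, hence in the range of `LL'`, and there `LL'S'` acts
as the identity. Transposing `M S M = M` is needed because `S` need not be symmetric. -/
lemma bVec_vecMul_covA (hn : n ≠ 0) (hX : X.rank = P) {A : Matrix (Fin k) (Fin P) ℝ}
    {S : Matrix (Fin k) (Fin k) ℝ} {p : ℕ} (hS : IsGenInverse (covA X A p) S) :
    bVec X A S p ᵥ* covA X A p = covC X A p := by
  set L := estMat X A p with hL
  have hcov : L * Lᵀ = covA X A p := estMat_mul_transpose hn hX A p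
  have hsymm : (covA X A p)ᵀ = covA X A p := by rw [← hcov, transpose_mul, transpose_transpose]
  have h1 : (1 - covA X A p * Sᵀ) * (L * Lᴴ) = 0 := by
    rw [conjTranspose_eq_transpose_of_trivial, hcov, Matrix.sub_mul, Matrix.one_mul]
    have := congrArg transpose hS
    rw [transpose_mul, transpose_mul, hsymm, ← Matrix.mul_assoc] at this
    rw [this, sub_self]
  -- Over the reals `B L L' = 0` forces `B L = 0`, so one factor `L'` can be cancelled.
  rw [mul_self_mul_conjTranspose_eq_zero, Matrix.sub_mul, Matrix.one_mul, sub_eq_zero] at h1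
  rw [bVec, vecMul_vecMul, ← mulVec_transpose, transpose_mul, hsymm,
    ← estMat_mulVec_coefRow hn hX, ← hL, mulVec_mulVec, ← h1]

lemma estMat_mulVec_condRow (hn : n ≠ 0) (hX : X.rank = P) {A : Matrix (Fin k) (Fin P) ℝ}
    {S : Matrix (Fin k) (Fin k) ℝ} {p : ℕ} (hS : IsGenInverse (covA X A p) S) :
    estMat X A p *ᵥ condRow X A S p = 0 := by
  have hsymm : (covA X A p)ᵀ = covA X A p := by
    rw [← estMat_mul_transpose hn hX, transpose_mul, transpose_transpose]
  rw [condRow, mulVec_sub, estMat_mulVec_coefRow hn hX, ← mulVec_transpose, mulVec_mulVec,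
    estMat_mul_transpose hn hX, ← hsymm, mulVec_transpose, bVec_vecMul_covA hn hX hS, sub_self]

/-- Pythagoras for the regression of `coefRow X p` on the rows of `estMat X A p`. In particular the
radicand in `ζ_{n,p}` is nonnegative, so the real square root truncates nothing. -/
lemma zeta_sq (hn : n ≠ 0) (hX : X.rank = P) {A : Matrix (Fin k) (Fin P) ℝ}
    {S : Matrix (Fin k) (Fin k) ℝ} {p : ℕ} (hS : IsGenInverse (covA X A p) S) :
    zeta X A S p ^ 2 = condRow X A S p ⬝ᵥ condRow X A S p := by
  have h : condRow X A S p ⬝ᵥ condRow X A S p = xi X p ^ 2 - bVec X A S p ⬝ᵥ covC X A p := by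
    conv_lhs =>
      arg 1
      rw [condRow]
    rw [sub_dotProduct, ← dotProduct_mulVec, estMat_mulVec_condRow hn hX hS, dotProduct_zero,
      sub_zero, condRow, dotProduct_sub,
      ← xi_sq hn hX, dotProduct_comm (coefRow X p), ← dotProduct_mulVec,
      estMat_mulVec_coefRow hn hX]
  rw [zeta, Real.sq_sqrt, h]
  rw [← h]
  exact Finset.sum_nonneg fun i _ => mul_self_nonneg _

lemma coefRow_dotProduct_condRow_of_lt (hX : X.rank = P) (A : Matrix (Fin k) (Fin P) ℝ)
    (S : Matrix (Fin k) (Fin k) ℝ) {p q : ℕ} (hpq : p < q) :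
    condRow X A S p ⬝ᵥ coefRow X q = 0 := by
  rw [condRow, sub_dotProduct, coefRow_dotProduct_coefRow hX hpq.ne, ← dotProduct_mulVec,
    estMat_mulVec_coefRow_of_lt hX A hpq, dotProduct_zero, sub_zero]

lemma residMat_mulVec_condRow (hX : X.rank = P) (A : Matrix (Fin k) (Fin P) ℝ)
    (S : Matrix (Fin k) (Fin k) ℝ) (p : ℕ) : residMat X *ᵥ condRow X A S p = 0 := by
  have h : residMat X * (estMat X A p)ᵀ = 0 := by
    rw [← transpose_eq_zero, transpose_mul, transpose_transpose, estMat_mul_residMat hX]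
  rw [condRow, mulVec_sub, residMat_mulVec_coefRow hX, ← mulVec_transpose, mulVec_mulVec, h,
    zero_mulVec, sub_zero]

end LinearAlgebra

/-! ### The selection event and its joint law with the estimator -/

section Selection

variable {X : Matrix (Fin n) (Fin P) ℝ}

lemma Delta_eq (s a b : ℝ) :
    Delta s a b = (gaussianReal 0 (s ^ 2).toNNReal).real {x | |a + x| < b} := by
  have h : (gaussianReal 0 (s ^ 2).toNNReal).map (fun x => -x) =
      gaussianReal 0 (s ^ 2).toNNReal := by
    rw [gaussianReal_map_neg, neg_zero]
  rw [Delta]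
  conv_lhs => rw [← h]
  rw [map_measureReal_apply measurable_neg (measurableSet_lt (by fun_prop) measurable_const)]
  congr 1
  ext x
  simp only [Set.mem_preimage, Set.mem_ofPred_eq]
  rw [← abs_neg]
  ring_nf

lemma one_sub_Delta_eq (s a b : ℝ) :
    1 - Delta s a b = (gaussianReal 0 (s ^ 2).toNNReal).real {x | b ≤ |a + x|} := by
  rw [Delta_eq, ← probReal_compl_eq_one_sub (measurableSet_lt (by fun_prop) measurable_const)]
  congr 1
  ext x
  simp

lemma select_eq_iff_of_ne_zero (c : ℕ → ℝ) (s : ℝ) (Y : Fin n → ℝ) {p : ℕ} (hp : p ≠ 0)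
    (hpP : p ≤ P) :
    select X c s Y = p ↔
      c p ≤ |testStat X s p Y| ∧ ∀ q ∈ Finset.Ioc p P, |testStat X s q Y| < c q := by
  rw [select, Nat.findGreatest_eq_iff]
  simp only [hp, hpP, true_and, ne_eq, not_false_eq_true, forall_const, Finset.mem_Ioc, and_imp,
    ge_iff_le, not_le]

/-- A nonpositive threshold is always passed. This covers `p = 0` too, where `Nat.findGreatest`
imposes no condition at `p` itself. -/
lemma select_eq_iff_of_nonpos {c : ℕ → ℝ} (s : ℝ) (Y : Fin n → ℝ) {p : ℕ} (hc : c p ≤ 0)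
    (hpP : p ≤ P) :
    select X c s Y = p ↔ ∀ q ∈ Finset.Ioc p P, |testStat X s q Y| < c q := by
  rw [select, Nat.findGreatest_eq_iff]
  simp only [hpP, true_and, Finset.mem_Ioc, and_imp, ge_iff_le, not_le, and_iff_right_iff_imp]
  exact fun _ _ => hc.trans (abs_nonneg _)

lemma abs_testStat (hX : X.rank = P) (θ : Fin P → ℝ) {σ s : ℝ} (hσ : 0 < σ)
    (hs : 0 < s) {q : ℕ} (hq : 0 < q) (u : Fin n → ℝ) :
    |testStat X (σ * s) q (X *ᵥ θ + u)| =
      |√(n : ℝ) * comp (eta X θ q) q + coefRow X q ⬝ᵥ u| / (s * σ * xi X q) := by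
  rw [testStat, if_neg hq.ne', comp_restrictedLS_add hX, abs_div, abs_mul (σ * s),
    abs_of_pos (mul_pos hσ hs), abs_of_nonneg (show 0 ≤ xi X q from Real.sqrt_nonneg _),
    mul_comm σ s]

lemma abs_testStat_lt_iff (hn : n ≠ 0) (hX : X.rank = P) (θ : Fin P → ℝ) (c : ℕ → ℝ) {σ s : ℝ}
    (hσ : 0 < σ) (hs : 0 < s) {q : ℕ} (hq : 0 < q) (hqP : q ≤ P) (u : Fin n → ℝ) :
    |testStat X (σ * s) q (X *ᵥ θ + u)| < c q ↔
      |√(n : ℝ) * comp (eta X θ q) q + coefRow X q ⬝ᵥ u| < s * c q * σ * xi X q := by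
  rw [abs_testStat hX θ hσ hs hq, div_lt_iff₀ (mul_pos (mul_pos hs hσ) (xi_pos hn hX hq hqP))]
  ring_nf

lemma le_abs_testStat_iff (hn : n ≠ 0) (hX : X.rank = P) (θ : Fin P → ℝ) (c : ℕ → ℝ) {σ s : ℝ}
    (hσ : 0 < σ) (hs : 0 < s) {q : ℕ} (hq : 0 < q) (hqP : q ≤ P) (u : Fin n → ℝ) :
    c q ≤ |testStat X (σ * s) q (X *ᵥ θ + u)| ↔
      s * c q * σ * xi X q ≤ |√(n : ℝ) * comp (eta X θ q) q + coefRow X q ⬝ᵥ u| := by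
  simpa only [not_lt] using (abs_testStat_lt_iff hn hX θ c hσ hs hq hqP u).not

lemma gaussPhi_eq_map (hn : n ≠ 0) (hX : X.rank = P) (A : Matrix (Fin k) (Fin P) ℝ) (σ : ℝ)
    (p : ℕ) :
    gaussPhi X A σ p =
      (iidGaussian (Fin n) (σ ^ 2).toNNReal).map (fun x => estMat X A p *ᵥ x) := by
  rw [map_mulVec_iidGaussian, estMat_mul_transpose hn hX, Real.coe_toNNReal _ (sq_nonneg σ),
    gaussPhi]

lemma gam_eq (hn : n ≠ 0) (hX : X.rank = P) (θ : Fin P → ℝ) (σ : ℝ) (c : ℕ → ℝ) (q : ℕ) (s : ℝ) :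
    gam X θ σ c q s =
      (gaussianReal 0 ((σ ^ 2).toNNReal * (coefRow X q ⬝ᵥ coefRow X q)).toNNReal).real
        {x | |√(n : ℝ) * comp (eta X θ q) q + x| < s * c q * σ * xi X q} := by
  rw [gam, Delta_eq, mul_pow, xi_sq hn hX, Real.coe_toNNReal _ (sq_nonneg σ)]

lemma one_sub_gamStar_eq (hn : n ≠ 0) (hX : X.rank = P) {A : Matrix (Fin k) (Fin P) ℝ}
    {S : Matrix (Fin k) (Fin k) ℝ} {p : ℕ} (hS : IsGenInverse (covA X A p) S) (θ : Fin P → ℝ)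
    (σ : ℝ) (c : ℕ → ℝ) (z : Fin k → ℝ) (s : ℝ) :
    1 - gamStar X A S θ σ c p z s =
      (gaussianReal 0 ((σ ^ 2).toNNReal *
        (condRow X A S p ⬝ᵥ condRow X A S p)).toNNReal).real
        {x | s * c p * σ * xi X p ≤
          |√(n : ℝ) * comp (eta X θ p) p + bVec X A S p ⬝ᵥ z + x|} := by
  rw [gamStar, one_sub_Delta_eq, mul_pow, zeta_sq hn hX hS, Real.coe_toNNReal _ (sq_nonneg σ)]

variable {σ : ℝ} {f : (Fin n → ℝ) → ℝ}

/-- The law of the estimator of minimal order on the event that this order is selected, where the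
scale is a positive function of the residuals. -/
lemma measureReal_select_eq_min (hn : n ≠ 0) (hX : X.rank = P) (A : Matrix (Fin k) (Fin P) ℝ)
    (θ : Fin P → ℝ) (hσ : 0 < σ) {c : ℕ → ℝ} {O : ℕ} (hO : O ≤ P) (hcO : c O = 0)
    (hf : Measurable f)
    (hpos : ∀ᵐ x ∂iidGaussian (Fin n) (σ ^ 2).toNNReal, 0 < f (residMat X *ᵥ x))
    {B : Set (Fin k → ℝ)} (hB : MeasurableSet B) :
    (iidGaussian (Fin n) (σ ^ 2).toNNReal).real
        {x | estMat X A O *ᵥ x ∈ B ∧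
          select X c (σ * f (residMat X *ᵥ x)) (X *ᵥ θ + x) = O} =
      (gaussPhi X A σ O).real B *
        ∫ s, ∏ q ∈ Finset.Ioc O P, gam X θ σ c q s
          ∂(iidGaussian (Fin n) (σ ^ 2).toNNReal).map (fun x => f (residMat X *ᵥ x)) := by
  set v := (σ ^ 2).toNNReal
  let G : Matrix (Finset.Ioc O P) (Fin n) ℝ := Matrix.of fun j => coefRow X j
  let D : Finset.Ioc O P → Set (((Fin k → ℝ) × ℝ) × ℝ) := fun j =>
    {w | |√(n : ℝ) * comp (eta X θ j) j + w.2| < w.1.2 * c j * σ * xi X j}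
  have hD (j) : MeasurableSet (D j) := measurableSet_lt (by fun_prop) (by fun_prop)
  have hG (i j) (hij : i ≠ j) : G i ⬝ᵥ G j = 0 :=
    coefRow_dotProduct_coefRow hX fun h => hij (Subtype.ext h)
  have hLG : estMat X A O * Gᵀ = 0 := by
    ext i j
    exact congrFun (estMat_mulVec_coefRow_of_lt hX A (Finset.mem_Ioc.1 j.2).1) i
  have hKG : residMat X * Gᵀ = 0 := by
    ext i j
    exact congrFun (residMat_mulVec_coefRow hX j) i
  have hlaw := map_prod_mulVec_iidGaussian v (estMat_mul_residMat hX A O) hLG hKG hG hf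
  have hmf : Measurable fun x => f (residMat X *ᵥ x) := hf.comp (measurable_mulVec _)
  have : IsProbabilityMeasure ((iidGaussian (Fin n) v).map fun x => f (residMat X *ᵥ x)) :=
    Measure.isProbabilityMeasure_map hmf.aemeasurable
  have : IsProbabilityMeasure ((iidGaussian (Fin n) v).map fun x => estMat X A O *ᵥ x) :=
    Measure.isProbabilityMeasure_map (measurable_mulVec _).aemeasurable
  have h1 := measureReal_prod_prod_pi ((iidGaussian (Fin n) v).map fun x => estMat X A O *ᵥ x)
    ((iidGaussian (Fin n) v).map fun x => f (residMat X *ᵥ x))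
    (fun j => gaussianReal 0 (v * (G j ⬝ᵥ G j)).toNNReal) hB hD
  rw [← hlaw, map_measureReal_apply
    ((measurable_mulVec _).prodMk (hmf.prodMk (measurable_mulVec _)))
    (measurableSet_prod_forall hB hD)] at h1
  have h2 : {x | estMat X A O *ᵥ x ∈ B ∧
      select X c (σ * f (residMat X *ᵥ x)) (X *ᵥ θ + x) = O} =ᵐ[iidGaussian (Fin n) v]
      (fun x => (estMat X A O *ᵥ x, f (residMat X *ᵥ x), G *ᵥ x)) ⁻¹'
        {w | w.1 ∈ B ∧ ∀ j, ((w.1, w.2.1), w.2.2 j) ∈ D j} := by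
    -- Clearing the denominator of the test statistics needs a positive scale, so the events agree
    -- only almost everywhere.
    filter_upwards [hpos] with x hx
    refine propext (and_congr_right fun _ => ?_)
    rw [select_eq_iff_of_nonpos _ _ hcO.le hO, Subtype.forall]
    refine forall₂_congr fun q hq => ?_
    obtain ⟨hq1, hq2⟩ := Finset.mem_Ioc.1 hq
    exact abs_testStat_lt_iff hn hX θ c hσ hx (by omega) hq2 x
  -- The inner integral does not involve `z`; the factor `Φ(B)` is rewritten as a set integral of a
  -- constant to match Fubini.
  rw [measureReal_congr h2, h1, ← gaussPhi_eq_map hn hX, ← smul_eq_mul, ← setIntegral_const]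
  congr with z
  congr with s
  rw [← Finset.prod_coe_sort _ fun q => gam X θ σ c q s]
  exact Finset.prod_congr rfl fun q _ => (gam_eq hn hX θ σ c q s).symm

/-- The law of the estimator of order `p` on the event that `p` is selected, where the scale is a
positive function of the residuals. -/
lemma measureReal_select_eq (hn : n ≠ 0) (hX : X.rank = P) {A : Matrix (Fin k) (Fin P) ℝ}
    (θ : Fin P → ℝ) (hσ : 0 < σ) {c : ℕ → ℝ} {p : ℕ} (hp : p ≠ 0) (hpP : p ≤ P)
    {S : Matrix (Fin k) (Fin k) ℝ} (hS : IsGenInverse (covA X A p) S)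
    (hf : Measurable f)
    (hpos : ∀ᵐ x ∂iidGaussian (Fin n) (σ ^ 2).toNNReal, 0 < f (residMat X *ᵥ x))
    {B : Set (Fin k → ℝ)} (hB : MeasurableSet B) :
    (iidGaussian (Fin n) (σ ^ 2).toNNReal).real
        {x | estMat X A p *ᵥ x ∈ B ∧
          select X c (σ * f (residMat X *ᵥ x)) (X *ᵥ θ + x) = p} =
      ∫ z in B, (∫ s, (1 - gamStar X A S θ σ c p z s) * ∏ q ∈ Finset.Ioc p P, gam X θ σ c q s
          ∂(iidGaussian (Fin n) (σ ^ 2).toNNReal).map (fun x => f (residMat X *ᵥ x)))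
        ∂gaussPhi X A σ p := by
  set v := (σ ^ 2).toNNReal
  -- The index `none` stands for order `p`, through the regression remainder; `some j` stands for
  -- the later orders. Only the condition at `none` depends on the value `z` of the estimator.
  let G : Matrix (Option (Finset.Ioc p P)) (Fin n) ℝ := Matrix.of fun j =>
    j.elim (condRow X A S p) fun j => coefRow X j
  let D : Option (Finset.Ioc p P) → Set (((Fin k → ℝ) × ℝ) × ℝ) := fun j =>
    j.elim {w | w.1.2 * c p * σ * xi X p ≤
        |√(n : ℝ) * comp (eta X θ p) p + bVec X A S p ⬝ᵥ w.1.1 + w.2|}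
      fun j => {w | |√(n : ℝ) * comp (eta X θ j) j + w.2| < w.1.2 * c j * σ * xi X j}
  have hD (j) : MeasurableSet (D j) := by
    rcases j with _ | j
    · have : Measurable fun w : ((Fin k → ℝ) × ℝ) × ℝ => bVec X A S p ⬝ᵥ w.1.1 :=
        (measurable_dotProduct _).comp (by fun_prop)
      exact measurableSet_le (by fun_prop) (by fun_prop)
    · exact measurableSet_lt (by fun_prop) (by fun_prop)
  have hlt (j : Finset.Ioc p P) : p < j := (Finset.mem_Ioc.1 j.2).1
  have hG (i j) (hij : i ≠ j) : G i ⬝ᵥ G j = 0 := by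
    rcases i with _ | i <;> rcases j with _ | j
    · exact absurd rfl hij
    · exact coefRow_dotProduct_condRow_of_lt hX A S (hlt j)
    · exact (dotProduct_comm _ _).trans (coefRow_dotProduct_condRow_of_lt hX A S (hlt i))
    · exact coefRow_dotProduct_coefRow hX fun h => hij (congrArg some (Subtype.ext h))
  have hLG : estMat X A p * Gᵀ = 0 := by
    ext i (_ | j)
    · exact congrFun (estMat_mulVec_condRow hn hX hS) i
    · exact congrFun (estMat_mulVec_coefRow_of_lt hX A (hlt j)) i
  have hKG : residMat X * Gᵀ = 0 := by
    ext i (_ | j)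
    · exact congrFun (residMat_mulVec_condRow hX A S p) i
    · exact congrFun (residMat_mulVec_coefRow hX j) i
  have hlaw := map_prod_mulVec_iidGaussian v (estMat_mul_residMat hX A p) hLG hKG hG hf
  have hmf : Measurable fun x => f (residMat X *ᵥ x) := hf.comp (measurable_mulVec _)
  have : IsProbabilityMeasure ((iidGaussian (Fin n) v).map fun x => f (residMat X *ᵥ x)) :=
    Measure.isProbabilityMeasure_map hmf.aemeasurable
  have : IsProbabilityMeasure ((iidGaussian (Fin n) v).map fun x => estMat X A p *ᵥ x) :=
    Measure.isProbabilityMeasure_map (measurable_mulVec _).aemeasurable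
  have h1 := measureReal_prod_prod_pi ((iidGaussian (Fin n) v).map fun x => estMat X A p *ᵥ x)
    ((iidGaussian (Fin n) v).map fun x => f (residMat X *ᵥ x))
    (fun j => gaussianReal 0 (v * (G j ⬝ᵥ G j)).toNNReal) hB hD
  rw [← hlaw, map_measureReal_apply
    ((measurable_mulVec _).prodMk (hmf.prodMk (measurable_mulVec _)))
    (measurableSet_prod_forall hB hD)] at h1
  have h2 : {x | estMat X A p *ᵥ x ∈ B ∧
      select X c (σ * f (residMat X *ᵥ x)) (X *ᵥ θ + x) = p} =ᵐ[iidGaussian (Fin n) v]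
      (fun x => (estMat X A p *ᵥ x, f (residMat X *ᵥ x), G *ᵥ x)) ⁻¹'
        {w | w.1 ∈ B ∧ ∀ j, ((w.1, w.2.1), w.2.2 j) ∈ D j} := by
    filter_upwards [hpos] with x hx
    refine propext (and_congr_right fun _ => ?_)
    rw [select_eq_iff_of_ne_zero _ _ _ hp hpP, Option.forall, Subtype.forall]
    refine and_congr ?_ (forall₂_congr fun q hq => ?_)
    · rw [le_abs_testStat_iff hn hX θ c hσ hx (Nat.pos_of_ne_zero hp) hpP x,
        coefRow_dotProduct_eq X A S, ← add_assoc]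
      rfl
    · obtain ⟨hq1, hq2⟩ := Finset.mem_Ioc.1 hq
      exact abs_testStat_lt_iff hn hX θ c hσ hx (by omega) hq2 x
  rw [measureReal_congr h2, h1, ← gaussPhi_eq_map hn hX]
  congr with z
  congr with s
  rw [Fintype.prod_option, ← Finset.prod_coe_sort _ fun q => gam X θ σ c q s,
    one_sub_gamStar_eq hn hX hS]
  congr 1
  exact Finset.prod_congr rfl fun q _ => (gam_eq hn hX θ σ c q s).symm

end Selection

/-! ### The law of the normalized residual scale -/

section ChiLaw

lemma iidGaussian_one_eq_withDensity (ι : Type*) [Fintype ι] :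
    iidGaussian ι 1 = volume.withDensity fun x : ι → ℝ =>
      ENNReal.ofReal (∏ i, gaussianPDFReal 0 1 (x i)) := by
  refine Measure.pi_eq fun s hs => ?_
  have hint : Integrable (fun x : ι → ℝ => ∏ i, gaussianPDFReal 0 1 (x i)) :=
    Integrable.fintype_prod fun _ => integrable_gaussianPDFReal 0 1
  rw [withDensity_apply _ (MeasurableSet.univ_pi hs), ← ofReal_integral_eq_lintegral_ofReal
    hint.integrableOn (Filter.Eventually.of_forall fun x =>
      Finset.prod_nonneg fun i _ => gaussianPDFReal_nonneg _ _ _), volume_pi,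
    Measure.restrict_pi_pi, integral_fintype_prod_eq_prod (fun _ => gaussianPDFReal 0 1),
    ENNReal.ofReal_prod_of_nonneg fun i _ => integral_nonneg fun x => gaussianPDFReal_nonneg _ _ _]
  exact Finset.prod_congr rfl fun i _ => (gaussianReal_apply_eq_integral 0 one_ne_zero (s i)).symm

lemma chiDensity_nonneg (m : ℕ) (s : ℝ) : 0 ≤ chiDensity m s := by
  unfold chiDensity
  split_ifs
  · have : 0 ≤ Real.Gamma ((m : ℝ) / 2) := Real.Gamma_nonneg_of_nonneg (by positivity)
    positivity
  · rfl

lemma measurable_chiDensity (m : ℕ) : Measurable (chiDensity m) :=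
  Measurable.ite measurableSet_Ioi (by fun_prop) measurable_const

lemma integrable_chiDensity (hm : 0 < m) : Integrable (chiDensity m) := by
  -- Since `m ≥ 1`, the natural power `m - 1` is the real power with exponent `m - 1 > -1`, as
  -- integrability near zero requires.
  have h : (fun s => chiDensity m s) = (Set.Ioi (0 : ℝ)).indicator fun s =>
      (2 * ((m : ℝ) / 2) ^ ((m : ℝ) / 2) / Real.Gamma ((m : ℝ) / 2)) *
        (s ^ ((m : ℝ) - 1) * Real.exp (-((m : ℝ) / 2) * s ^ 2)) := by
    ext s
    rw [chiDensity]
    by_cases hs : 0 < s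
    · rw [if_pos hs, Set.indicator_of_mem (Set.mem_Ioi.2 hs), ← Nat.cast_pred hm,
        Real.rpow_natCast, mul_assoc]
      ring_nf
    · rw [if_neg hs, Set.indicator_of_notMem (by exact hs)]
  have hm' : (0 : ℝ) < m := by exact_mod_cast hm
  change Integrable fun s => chiDensity m s
  rw [h, integrable_indicator_iff measurableSet_Ioi]
  exact (integrable_rpow_mul_exp_neg_mul_sq (by positivity) (by linarith)).integrableOn.const_mul _

/-- On the left, `m` times the unit-ball volume is the area of the sphere, the powers of `√m` come
from the substitution `r = √m s`, and the last factor normalizes the Gaussian density. The identity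
rests on `Γ(m/2 + 1) = (m/2) Γ(m/2)`. -/
lemma chi_normalization (hm : 0 < m) :
    (m : ℝ) * (√Real.pi ^ m / Real.Gamma ((m : ℝ) / 2 + 1)) *
        (√(m : ℝ) * √(m : ℝ) ^ (m - 1) * (√(2 * Real.pi))⁻¹ ^ m) =
      2 * ((m : ℝ) / 2) ^ ((m : ℝ) / 2) / Real.Gamma ((m : ℝ) / 2) := by
  have hm' : (0 : ℝ) < m := by exact_mod_cast hm
  have hG : 0 < Real.Gamma ((m : ℝ) / 2) := Real.Gamma_pos_of_pos (by positivity)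
  have h1 : ((m : ℝ) / 2) ^ ((m : ℝ) / 2) = (√(m : ℝ) / √2) ^ m := by
    rw [← Real.sqrt_div hm'.le, ← Real.rpow_natCast, Real.sqrt_eq_rpow,
      ← Real.rpow_mul (by positivity)]
    congr 1
    ring
  rw [Real.Gamma_add_one (by positivity), h1, ← pow_succ', Nat.sub_add_cancel hm,
    Real.sqrt_mul two_pos.le, div_pow, inv_pow, mul_pow]
  have hpi : √Real.pi ≠ 0 := (Real.sqrt_pos.2 Real.pi_pos).ne'
  have h2 : √(2 : ℝ) ≠ 0 := (Real.sqrt_pos.2 two_pos).ne'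
  field_simp

/-- The Gaussian density and the event depend on `x` only through `‖x‖`, so polar coordinates reduce
the probability to a one-dimensional integral. -/
lemma map_sqrt_dotProduct_self_iidGaussian (hm : 0 < m) :
    (iidGaussian (Fin m) 1).map (fun x => √((m : ℝ)⁻¹ * (x ⬝ᵥ x))) =
      volume.withDensity fun s => ENNReal.ofReal (chiDensity m s) := by
  have hm' : (0 : ℝ) < m := by exact_mod_cast hm
  have hsm : 0 < √(m : ℝ) := Real.sqrt_pos.2 hm'
  have : Nonempty (Fin m) := ⟨⟨0, hm⟩⟩
  have hmeas : Measurable fun x : Fin m → ℝ => √((m : ℝ)⁻¹ * (x ⬝ᵥ x)) :=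
    (Real.continuous_sqrt.comp (continuous_const.mul
      (Continuous.dotProduct continuous_id continuous_id))).measurable
  ext s hs
  let F : ℝ → ℝ := fun r => s.indicator (fun _ => (√(2 * Real.pi))⁻¹ ^ m * Real.exp (-r ^ 2 / 2))
    (√((m : ℝ)⁻¹ * r ^ 2))
  have hint : Integrable (fun x : Fin m → ℝ => ∏ i, gaussianPDFReal 0 1 (x i)) :=
    Integrable.fintype_prod fun _ => integrable_gaussianPDFReal 0 1
  have hpdf (x : Fin m → ℝ) : ∏ i, gaussianPDFReal 0 1 (x i) =
      (√(2 * Real.pi))⁻¹ ^ m * Real.exp (-(x ⬝ᵥ x) / 2) := by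
    simp only [gaussianPDFReal, NNReal.coe_one, mul_one, sub_zero, Finset.prod_mul_distrib,
      Finset.prod_const, Finset.card_univ, Fintype.card_fin, ← Real.exp_sum]
    congr 2
    simp only [dotProduct, ← Finset.sum_div, Finset.sum_neg_distrib, sq]
  have hnorm (x : Fin m → ℝ) : ‖WithLp.toLp 2 x‖ ^ 2 = x ⬝ᵥ x := by
    rw [EuclideanSpace.real_norm_sq_eq]
    exact Finset.sum_congr rfl fun i _ => sq _
  rw [Measure.map_apply hmeas hs, iidGaussian_one_eq_withDensity,
    withDensity_apply _ (hmeas hs), withDensity_apply _ hs,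
    ← ofReal_integral_eq_lintegral_ofReal hint.integrableOn (Filter.Eventually.of_forall fun x =>
      Finset.prod_nonneg fun i _ => gaussianPDFReal_nonneg _ _ _),
    ← ofReal_integral_eq_lintegral_ofReal (integrable_chiDensity hm).integrableOn
      (Filter.Eventually.of_forall fun x => chiDensity_nonneg _ _)]
  congr 1
  have h1 : ∫ x in (fun x : Fin m → ℝ => √((m : ℝ)⁻¹ * (x ⬝ᵥ x))) ⁻¹' s,
      ∏ i, gaussianPDFReal 0 1 (x i) = ∫ x : EuclideanSpace ℝ (Fin m), F ‖x‖ := by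
    rw [← integral_indicator (hmeas hs), ← (PiLp.volume_preserving_toLp (Fin m)).integral_comp
      (MeasurableEquiv.toLp 2 (Fin m → ℝ)).measurableEmbedding]
    congr with x
    have hF : F ‖WithLp.toLp 2 x‖ = s.indicator
        (fun _ => (√(2 * Real.pi))⁻¹ ^ m * Real.exp (-(x ⬝ᵥ x) / 2)) √((m : ℝ)⁻¹ * (x ⬝ᵥ x)) := by
      simp only [F]
      rw [hnorm]
    refine Eq.trans ?_ hF.symm
    simp only [Set.indicator, hpdf]
    rfl
  rw [h1, integral_fun_norm_addHaar, finrank_euclideanSpace, Fintype.card_fin, measureReal_def,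
    EuclideanSpace.volume_ball, Fintype.card_fin, ENNReal.ofReal_one, one_pow, one_mul,
    ENNReal.toReal_ofReal (div_nonneg (by positivity)
      (Real.Gamma_nonneg_of_nonneg (by positivity)))]
  -- Substitute `r = √m s`, which turns `√(r²/m)` into `s`.
  have h2 := integral_comp_mul_left_Ioi (fun y => y ^ (m - 1) • F y) 0 hsm
  rw [mul_zero, eq_inv_smul_iff₀ hsm.ne'] at h2
  rw [← h2, ← integral_indicator hs]
  have h3 : ∫ x, s.indicator (chiDensity m) x =
      ∫ x in Set.Ioi (0 : ℝ), s.indicator (chiDensity m) x := by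
    refine (setIntegral_eq_integral_of_forall_compl_eq_zero fun x hx => ?_).symm
    have : chiDensity m x = 0 := if_neg hx
    simp [Set.indicator, this]
  rw [h3, nsmul_eq_mul, smul_eq_mul, smul_eq_mul, ← mul_assoc, ← mul_assoc,
    ← integral_const_mul]
  refine setIntegral_congr_fun measurableSet_Ioi fun r hr => ?_
  have hr' : 0 < r := hr
  have hsq : √((m : ℝ)⁻¹ * (√(m : ℝ) * r) ^ 2) = r := by
    rw [mul_pow, Real.sq_sqrt hm'.le, inv_mul_cancel_left₀ hm'.ne', Real.sqrt_sq hr'.le]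
  simp only [F, hsq]
  by_cases hrs : r ∈ s
  · rw [Set.indicator_of_mem hrs, Set.indicator_of_mem hrs, chiDensity, if_pos hr',
      ← chi_normalization hm, mul_pow, mul_pow, Real.sq_sqrt hm'.le, smul_eq_mul, neg_div]
    ring
  · rw [Set.indicator_of_notMem hrs, Set.indicator_of_notMem hrs]
    simp

variable {X : Matrix (Fin n) (Fin P) ℝ}

/-- Orthonormal coordinates on the orthogonal complement of the column space of `X`. -/
lemma exists_orthonormal_residMat (hX : X.rank = P) :
    ∃ V : Matrix (Fin (n - P)) (Fin n) ℝ, V * Vᵀ = 1 ∧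
      ∀ x, (residMat X *ᵥ x) ⬝ᵥ (residMat X *ᵥ x) = (V *ᵥ x) ⬝ᵥ (V *ᵥ x) := by
  let K : Submodule ℝ (EuclideanSpace ℝ (Fin n)) :=
    (LinearMap.ker Xᵀ.mulVecLin).map (WithLp.linearEquiv 2 ℝ (Fin n → ℝ)).symm.toLinearMap
  have hK (y : EuclideanSpace ℝ (Fin n)) : y ∈ K ↔ Xᵀ *ᵥ y.ofLp = 0 := by
    constructor
    · rintro ⟨z, hz, rfl⟩
      exact hz
    · exact fun h => ⟨y.ofLp, h, rfl⟩
  have hdim : Module.finrank ℝ K = n - P := by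
    rw [LinearEquiv.finrank_map_eq]
    have h := LinearMap.finrank_range_add_finrank_ker Xᵀ.mulVecLin
    rw [Module.finrank_fin_fun] at h
    have h' : Module.finrank ℝ (LinearMap.range Xᵀ.mulVecLin) = P := (rank_transpose X).trans hX
    omega
  let b : OrthonormalBasis (Fin (n - P)) ℝ K := (stdOrthonormalBasis ℝ K).reindex (finCongr hdim)
  have hin (y z : EuclideanSpace ℝ (Fin n)) : inner ℝ y z = y.ofLp ⬝ᵥ z.ofLp := by
    rw [EuclideanSpace.inner_eq_star_dotProduct, star_trivial, dotProduct_comm]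
  -- `K` is the kernel of `X'`, on which the projection acts as the identity.
  have hres (i) : residMat X *ᵥ (b i : EuclideanSpace ℝ (Fin n)).ofLp =
      (b i : EuclideanSpace ℝ (Fin n)).ofLp := by
    have h := (hK _).1 (b i).2
    have h' : (firstCols X P)ᵀ *ᵥ (b i : EuclideanSpace ℝ (Fin n)).ofLp = 0 := by
      ext j
      exact congrFun h j
    rw [residMat, sub_mulVec, one_mulVec, ← mulVec_mulVec, ← mulVec_mulVec, h', mulVec_zero,
      mulVec_zero, sub_zero]
  refine ⟨Matrix.of fun i => (b i : EuclideanSpace ℝ (Fin n)).ofLp, ?_, fun x => ?_⟩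
  · ext i j
    have := b.inner_eq_ite i j
    rw [Submodule.coe_inner, hin] at this
    rw [Matrix.one_apply, ← this]
    rfl
  -- Parseval in `K` for the residual; by symmetry of the projection its coefficients are those of
  -- `x` itself.
  · have hmem : WithLp.toLp 2 (residMat X *ᵥ x) ∈ K := by
      rw [hK, mulVec_mulVec, ← transpose_residMat, ← transpose_mul, residMat_mul_self hX,
        transpose_zero, zero_mulVec]
    have h := b.sum_sq_inner_right ⟨_, hmem⟩
    have h' := real_inner_self_eq_norm_sq (WithLp.toLp 2 (residMat X *ᵥ x))
    rw [hin] at h'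
    rw [h', ← Submodule.coe_norm (⟨_, hmem⟩ : K), ← h]
    refine Finset.sum_congr rfl fun i _ => ?_
    rw [Submodule.coe_inner, hin, sq]
    have : (b i : EuclideanSpace ℝ (Fin n)).ofLp ⬝ᵥ (residMat X *ᵥ x) =
        (b i : EuclideanSpace ℝ (Fin n)).ofLp ⬝ᵥ x := by
      rw [dotProduct_mulVec, ← mulVec_transpose, transpose_residMat, hres]
    rw [this]
    rfl

/-- `V x / σ` has `n - P` independent standard normal coordinates because the rows of `V` are
orthonormal, and its squared length is that of the residual over `σ²`. -/
lemma map_sqrt_residMat_iidGaussian (hPn : P < n) (hX : X.rank = P) {σ : ℝ} (hσ : 0 < σ) :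
    (iidGaussian (Fin n) (σ ^ 2).toNNReal).map
        (fun x => √(((n : ℝ) - P)⁻¹ * ((residMat X *ᵥ x) ⬝ᵥ (residMat X *ᵥ x))) / σ) =
      volume.withDensity fun s => ENNReal.ofReal (chiDensity (n - P) s) := by
  obtain ⟨V, hV, hVx⟩ := exists_orthonormal_residMat hX
  have hmeas : Measurable fun x : Fin (n - P) → ℝ => √(((n - P : ℕ) : ℝ)⁻¹ * (x ⬝ᵥ x)) :=
    (Real.continuous_sqrt.comp (continuous_const.mul
      (Continuous.dotProduct continuous_id continuous_id))).measurable
  have hrow (i j) : (σ⁻¹ • V) i ⬝ᵥ (σ⁻¹ • V) j = if i = j then (σ ^ 2)⁻¹ else 0 := by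
    have : V i ⬝ᵥ V j = if i = j then 1 else 0 := congrFun (congrFun hV i) j
    change (σ⁻¹ • V i) ⬝ᵥ (σ⁻¹ • V j) = _
    rw [smul_dotProduct, dotProduct_smul, this]
    split_ifs <;> simp [sq]
  have h := map_mulVec_iidGaussian_of_orthogonal (σ ^ 2).toNNReal (L := σ⁻¹ • V)
    fun i j hij => by rw [hrow, if_neg hij]
  simp only [hrow, if_true, Real.coe_toNNReal _ (sq_nonneg σ),
    mul_inv_cancel₀ (pow_ne_zero 2 hσ.ne'), Real.toNNReal_one] at h
  rw [← map_sqrt_dotProduct_self_iidGaussian (Nat.sub_pos_of_lt hPn),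
    iidGaussian.eq_1 (Fin (n - P)), ← h,
    Measure.map_map hmeas (measurable_mulVec _)]
  congr 1
  ext x
  simp only [Function.comp_apply]
  rw [smul_mulVec, smul_dotProduct, dotProduct_smul, ← hVx, Nat.cast_sub hPn.le,
    smul_smul, smul_eq_mul, ← mul_inv, ← sq, mul_left_comm,
    Real.sqrt_mul (inv_nonneg.2 (sq_nonneg σ)), Real.sqrt_inv, Real.sqrt_sq hσ.le, div_eq_inv_mul]

end ChiLaw

/-! ### Distributions for a general residual-based scale -/

section Distributions

variable {X : Matrix (Fin n) (Fin P) ℝ} {σ : ℝ} {f : (Fin n → ℝ) → ℝ}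

lemma measurable_select (hX : X.rank = P) (θ : Fin P → ℝ) (c : ℕ → ℝ) (hf : Measurable f) :
    Measurable fun x => select X c (σ * f (residMat X *ᵥ x)) (X *ᵥ θ + x) := by
  refine measurable_findGreatest fun q _ => measurableSet_le measurable_const ?_
  have hmf : Measurable fun x => f (residMat X *ᵥ x) := hf.comp (measurable_mulVec _)
  have hr : Measurable fun x => coefRow X q ⬝ᵥ x := measurable_dotProduct _
  simp only [testStat, comp_restrictedLS_add hX]
  split_ifs
  · exact measurable_const
  · fun_prop

lemma measurableSet_select_eq (hX : X.rank = P) (A : Matrix (Fin k) (Fin P) ℝ) (θ : Fin P → ℝ)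
    (c : ℕ → ℝ) (hf : Measurable f) (p : ℕ) {B : Set (Fin k → ℝ)} (hB : MeasurableSet B) :
    MeasurableSet {x | estMat X A p *ᵥ x ∈ B ∧
      select X c (σ * f (residMat X *ᵥ x)) (X *ᵥ θ + x) = p} :=
  (measurable_mulVec _ hB).inter (measurable_select hX θ c hf (measurableSet_singleton p))

lemma le_select {c : ℕ → ℝ} {O : ℕ} (hO : O ≤ P) (hc : c O ≤ 0) (s : ℝ) (Y : Fin n → ℝ) :
    O ≤ select X c s Y :=
  Nat.le_findGreatest hO (hc.trans (abs_nonneg _))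

/-- Splitting by the selected order replaces the random-order estimator by one of fixed order on
each piece. Orders below `O` do not occur since the threshold at `O` is always passed. -/
lemma setOf_postSelection_le_eq (hX : X.rank = P) (A : Matrix (Fin k) (Fin P) ℝ) (θ : Fin P → ℝ)
    {c : ℕ → ℝ} {O : ℕ} (hO : O ≤ P) (hc : c O ≤ 0) (t : Fin k → ℝ) :
    {x | √(n : ℝ) • A *ᵥ (restrictedLS X (select X c (σ * f (residMat X *ᵥ x)) (X *ᵥ θ + x))
        (X *ᵥ θ + x) - θ) ≤ t} =
      ⋃ p ∈ Finset.Icc O P, {x | estMat X A p *ᵥ x ∈ Set.Iic (t - shift X A θ p) ∧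
        select X c (σ * f (residMat X *ᵥ x)) (X *ᵥ θ + x) = p} := by
  ext x
  simp only [Set.mem_ofPred_eq, Set.mem_iUnion, exists_prop, mulVec_restrictedLS_add hX,
    Set.mem_Iic, le_sub_iff_add_le]
  constructor
  · exact fun h => ⟨_, Finset.mem_Icc.2 ⟨le_select hO hc _ _, Nat.findGreatest_le P⟩, h, rfl⟩
  · rintro ⟨p, -, h, rfl⟩
    exact h

lemma measurableSet_postSelection_le (hX : X.rank = P) (A : Matrix (Fin k) (Fin P) ℝ)
    (θ : Fin P → ℝ) {c : ℕ → ℝ} {O : ℕ} (hO : O ≤ P) (hc : c O ≤ 0) (hf : Measurable f)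
    (t : Fin k → ℝ) :
    MeasurableSet {x | √(n : ℝ) • A *ᵥ (restrictedLS X
      (select X c (σ * f (residMat X *ᵥ x)) (X *ᵥ θ + x)) (X *ᵥ θ + x) - θ) ≤ t} := by
  rw [setOf_postSelection_le_eq hX A θ hO hc t]
  exact Finset.measurableSet_biUnion _ fun p _ =>
    measurableSet_select_eq hX A θ c hf p measurableSet_Iic

/-- The cdf of the post-model-selection estimator with a scale that is a positive function of the
residuals. -/
lemma measureReal_postSelection_le (hn : n ≠ 0) (hX : X.rank = P) (A : Matrix (Fin k) (Fin P) ℝ)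
    (θ : Fin P → ℝ) (hσ : 0 < σ) {c : ℕ → ℝ} {O : ℕ} (hO : O ≤ P) (hcO : c O = 0)
    {S : ℕ → Matrix (Fin k) (Fin k) ℝ}
    (hS : ∀ p, O < p → p ≤ P → IsGenInverse (covA X A p) (S p)) (hf : Measurable f)
    (hpos : ∀ᵐ x ∂iidGaussian (Fin n) (σ ^ 2).toNNReal, 0 < f (residMat X *ᵥ x))
    (t : Fin k → ℝ) :
    (iidGaussian (Fin n) (σ ^ 2).toNNReal).real
        {x | √(n : ℝ) • A *ᵥ (restrictedLS X
          (select X c (σ * f (residMat X *ᵥ x)) (X *ᵥ θ + x)) (X *ᵥ θ + x) - θ) ≤ t} =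
      (gaussPhi X A σ O).real (Set.Iic (t - shift X A θ O)) *
        (∫ s, ∏ q ∈ Finset.Ioc O P, gam X θ σ c q s
          ∂(iidGaussian (Fin n) (σ ^ 2).toNNReal).map (fun x => f (residMat X *ᵥ x))) +
      ∑ p ∈ Finset.Ioc O P, ∫ z in Set.Iic (t - shift X A θ p),
        (∫ s, (1 - gamStar X A (S p) θ σ c p z s) * ∏ q ∈ Finset.Ioc p P, gam X θ σ c q s
          ∂(iidGaussian (Fin n) (σ ^ 2).toNNReal).map (fun x => f (residMat X *ᵥ x)))
        ∂gaussPhi X A σ p := by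
  rw [setOf_postSelection_le_eq hX A θ hO hcO.le t, measureReal_biUnion_finset,
    Finset.Icc_eq_cons_Ioc hO, Finset.sum_cons,
    measureReal_select_eq_min hn hX A θ hσ hO hcO hf hpos measurableSet_Iic]
  · congr 1
    refine Finset.sum_congr rfl fun p hp => ?_
    obtain ⟨hp1, hp2⟩ := Finset.mem_Ioc.1 hp
    exact measureReal_select_eq hn hX θ hσ (by omega) hp2 (hS p hp1 hp2) hf hpos measurableSet_Iic
  · intro p _ q _ hpq
    exact Set.disjoint_left.2 fun x hx hx' => hpq (hx.2.symm.trans hx'.2)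
  · exact fun p _ => measurableSet_select_eq hX A θ c hf p measurableSet_Iic

instance (X : Matrix (Fin n) (Fin P) ℝ) (A : Matrix (Fin k) (Fin P) ℝ) (σ : ℝ) (p : ℕ) :
    IsProbabilityMeasure (gaussPhi X A σ p) :=
  Measure.isProbabilityMeasure_map (MeasurableEquiv.measurable _).aemeasurable

/-- The joint law with an `A` that has no rows: the condition on the estimator becomes empty. -/
lemma measureReal_select_eq_min' (hn : n ≠ 0) (hX : X.rank = P) (θ : Fin P → ℝ) (hσ : 0 < σ)
    {c : ℕ → ℝ} {O : ℕ} (hO : O ≤ P) (hcO : c O = 0) (hf : Measurable f)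
    (hpos : ∀ᵐ x ∂iidGaussian (Fin n) (σ ^ 2).toNNReal, 0 < f (residMat X *ᵥ x)) :
    (iidGaussian (Fin n) (σ ^ 2).toNNReal).real
        {x | select X c (σ * f (residMat X *ᵥ x)) (X *ᵥ θ + x) = O} =
      ∫ s, ∏ q ∈ Finset.Ioc O P, gam X θ σ c q s
        ∂(iidGaussian (Fin n) (σ ^ 2).toNNReal).map (fun x => f (residMat X *ᵥ x)) := by
  simpa using measureReal_select_eq_min hn hX (0 : Matrix (Fin 0) (Fin P) ℝ) θ hσ hO hcO hf hpos
    MeasurableSet.univ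

/-- With no rows there is nothing to regress on: the correction `b_{n,q} z` vanishes and `ζ_{n,q} =
ξ_{n,q}`. -/
lemma gamStar_fin_zero (A : Matrix (Fin 0) (Fin P) ℝ) (S : Matrix (Fin 0) (Fin 0) ℝ)
    (θ : Fin P → ℝ) (c : ℕ → ℝ) (q : ℕ) (z : Fin 0 → ℝ) (s : ℝ) :
    gamStar X A S θ σ c q z s = gam X θ σ c q s := by
  simp only [gamStar, gam, zeta, dotProduct_of_isEmpty, sub_zero, add_zero]
  rw [Real.sqrt_sq (show 0 ≤ xi X q from Real.sqrt_nonneg _)]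

lemma measureReal_select_eq' (hn : n ≠ 0) (hX : X.rank = P) (θ : Fin P → ℝ) (hσ : 0 < σ)
    {c : ℕ → ℝ} {p : ℕ} (hp : p ≠ 0) (hpP : p ≤ P) (hf : Measurable f)
    (hpos : ∀ᵐ x ∂iidGaussian (Fin n) (σ ^ 2).toNNReal, 0 < f (residMat X *ᵥ x)) :
    (iidGaussian (Fin n) (σ ^ 2).toNNReal).real
        {x | select X c (σ * f (residMat X *ᵥ x)) (X *ᵥ θ + x) = p} =
      ∫ s, (1 - gam X θ σ c p s) * ∏ q ∈ Finset.Ioc p P, gam X θ σ c q s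
        ∂(iidGaussian (Fin n) (σ ^ 2).toNNReal).map (fun x => f (residMat X *ᵥ x)) := by
  have h := measureReal_select_eq hn hX (A := (0 : Matrix (Fin 0) (Fin P) ℝ)) (S := 0) (c := c)
    θ hσ hp hpP (Subsingleton.elim _ _) hf hpos MeasurableSet.univ
  simpa [gamStar_fin_zero] using h

lemma integral_withDensity_chiDensity (m : ℕ) (g : ℝ → ℝ) :
    ∫ s, g s ∂(volume.withDensity fun s => ENNReal.ofReal (chiDensity m s)) =
      ∫ s in Set.Ioi (0 : ℝ), g s * chiDensity m s := by
  rw [integral_withDensity_eq_integral_toReal_smul (measurable_chiDensity m).ennreal_ofReal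
    (Filter.Eventually.of_forall fun _ => ENNReal.ofReal_lt_top)]
  rw [setIntegral_eq_integral_of_forall_compl_eq_zero fun s hs => by
    rw [show chiDensity m s = 0 from if_neg hs, mul_zero]]
  refine integral_congr_ae (Filter.Eventually.of_forall fun s => ?_)
  simp only [ENNReal.toReal_ofReal (chiDensity_nonneg m s), smul_eq_mul, mul_comm]

/-- `σ̂ / σ` as a function of the residuals. -/
def scaledResid (n P : ℕ) (σ : ℝ) (r : Fin n → ℝ) : ℝ := √(((n : ℝ) - P)⁻¹ * (r ⬝ᵥ r)) / σ

lemma measurable_scaledResid (n P : ℕ) (σ : ℝ) : Measurable (scaledResid n P σ) :=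
  ((Real.continuous_sqrt.comp (continuous_const.mul
    (Continuous.dotProduct continuous_id continuous_id))).div_const σ).measurable

lemma sigmaHat_eq_scaledResid (hX : X.rank = P) (θ : Fin P → ℝ) (hσ : 0 < σ) (u : Fin n → ℝ) :
    sigmaHat X (X *ᵥ θ + u) = σ * scaledResid n P σ (residMat X *ᵥ u) := by
  rw [sigmaHat_eq hX, scaledResid, mul_div_cancel₀ _ hσ.ne']

lemma map_scaledResid (hPn : P < n) (hX : X.rank = P) (hσ : 0 < σ) :
    (iidGaussian (Fin n) (σ ^ 2).toNNReal).map (fun x => scaledResid n P σ (residMat X *ᵥ x)) =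
      volume.withDensity fun s => ENNReal.ofReal (chiDensity (n - P) s) :=
  map_sqrt_residMat_iidGaussian hPn hX hσ

/-- The law has a density vanishing on `(-∞, 0]`. This excludes, up to a null set, division by `σ̂ =
0` in the test statistics. -/
lemma ae_scaledResid_pos (hPn : P < n) (hX : X.rank = P) (hσ : 0 < σ) :
    ∀ᵐ x ∂iidGaussian (Fin n) (σ ^ 2).toNNReal, 0 < scaledResid n P σ (residMat X *ᵥ x) := by
  have h : ∀ᵐ s ∂(volume.withDensity fun s => ENNReal.ofReal (chiDensity (n - P) s)),
      (0 : ℝ) < s := by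
    rw [ae_withDensity_iff (measurable_chiDensity _).ennreal_ofReal]
    refine Filter.Eventually.of_forall fun s hs => ?_
    by_contra hs0
    exact hs (by rw [show chiDensity (n - P) s = 0 from if_neg hs0, ENNReal.ofReal_zero])
  rw [← map_scaledResid hPn hX hσ] at h
  exact ae_of_ae_map ((measurable_scaledResid n P σ).comp (measurable_mulVec _)).aemeasurable h

lemma measureReal_setOf_hasLaw {Ω E : Type*} [MeasurableSpace Ω] [MeasurableSpace E]
    {ν : Measure Ω} {μ : Measure E} {u : Ω → E} (hu : HasLaw u μ ν) {Q : E → Prop}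
    (hQ : MeasurableSet {x | Q x}) : ν.real {ω | Q (u ω)} = μ.real {x | Q x} := by
  rw [← hu.map_eq, measureReal_def, measureReal_def,
    Measure.map_apply_of_aemeasurable hu.aemeasurable hQ]
  rfl

end Distributions

end PostModelSelection

end

/-! ### The main theorem -/

open PostModelSelection in
theorem mainTheorem1 {Ω : Type*} [MeasurableSpace Ω] (ν : Measure Ω) [IsProbabilityMeasure ν]
    {n P k O : ℕ} (hPn : P < n) (hO : O < P) (hk : 1 ≤ k)
    (X : Matrix (Fin n) (Fin P) ℝ) (hX : X.rank = P)
    (A : Matrix (Fin k) (Fin P) ℝ) (hA : A.rank = k)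
    (θ : Fin P → ℝ) (σ : ℝ) (hσ : 0 < σ)
    (c : ℕ → ℝ) (hcO : c O = 0) (hc : ∀ p, O < p → p ≤ P → 0 < c p)
    -- the errors `u ~ N(0, σ² I_n)` and the observations `Y = X θ + u`
    (u : Ω → Fin n → ℝ)
    (hu : HasLaw u (Measure.pi fun _ => gaussianReal 0 (σ ^ 2).toNNReal) ν)
    (Y : Ω → Fin n → ℝ) (hY : ∀ ω, Y ω = X *ᵥ θ + u ω)
    -- an arbitrary choice of the generalized inverses
    (S : ℕ → Matrix (Fin k) (Fin k) ℝ)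
    (hS : ∀ p, O < p → p ≤ P → IsGenInverse (covA X A p) (S p)) :
    -- `h` is the density of `σ̂ / σ`
    HasLaw (fun ω => sigmaHat X (Y ω) / σ)
      (volume.withDensity fun s => ENNReal.ofReal (chiDensity (n - P) s)) ν ∧
    -- model selection probabilities, known variance
    selProbStar ν Y X σ c O = ∏ q ∈ Finset.Ioc O P, gam X θ σ c q 1 ∧
    (∀ p, O < p → p ≤ P →
      selProbStar ν Y X σ c p =
        (1 - gam X θ σ c p 1) * ∏ q ∈ Finset.Ioc p P, gam X θ σ c q 1) ∧
    -- model selection probabilities, unknown variance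
    selProb ν Y X c O =
      ∫ s in Set.Ioi (0 : ℝ), (∏ q ∈ Finset.Ioc O P, gam X θ σ c q s) * chiDensity (n - P) s ∧
    (∀ p, O < p → p ≤ P →
      selProb ν Y X c p =
        ∫ s in Set.Ioi (0 : ℝ), (1 - gam X θ σ c p s) *
          (∏ q ∈ Finset.Ioc p P, gam X θ σ c q s) * chiDensity (n - P) s) ∧
    -- the cdf, known variance
    (∀ t : Fin k → ℝ,
      cdfGStar ν Y X A θ σ c t =
        (gaussPhi X A σ O).real (Set.Iic (t - shift X A θ O)) *
            ∏ q ∈ Finset.Ioc O P, gam X θ σ c q 1 +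
          ∑ p ∈ Finset.Ioc O P,
            (∫ z in Set.Iic (t - shift X A θ p),
              (1 - gamStar X A (S p) θ σ c p z 1) ∂(gaussPhi X A σ p)) *
            ∏ q ∈ Finset.Ioc p P, gam X θ σ c q 1) ∧
    -- the cdf, unknown variance
    (∀ t : Fin k → ℝ,
      cdfG ν Y X A θ c t =
        (gaussPhi X A σ O).real (Set.Iic (t - shift X A θ O)) *
            (∫ s in Set.Ioi (0 : ℝ),
              (∏ q ∈ Finset.Ioc O P, gam X θ σ c q s) * chiDensity (n - P) s) +
          ∑ p ∈ Finset.Ioc O P,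
            ∫ z in Set.Iic (t - shift X A θ p),
              (∫ s in Set.Ioi (0 : ℝ),
                (1 - gamStar X A (S p) θ σ c p z s) *
                  (∏ q ∈ Finset.Ioc p P, gam X θ σ c q s) * chiDensity (n - P) s)
              ∂(gaussPhi X A σ p)) := by
  have hn : n ≠ 0 := by omega
  have hf := measurable_scaledResid n P σ
  have hf1 : Measurable fun _ : Fin n → ℝ => (1 : ℝ) := measurable_const
  have hpos := ae_scaledResid_pos hPn hX hσ
  have hpos1 : ∀ᵐ _ ∂iidGaussian (Fin n) (σ ^ 2).toNNReal, (0 : ℝ) < 1 :=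
    Filter.Eventually.of_forall fun _ => one_pos
  -- Known variance is the constant function `f = 1`: integrals over its law evaluate the integrand
  -- at `s = 1`.
  have hρ1 : (iidGaussian (Fin n) (σ ^ 2).toNNReal).map (fun _ => (1 : ℝ)) =
      Measure.dirac 1 := by
    rw [Measure.map_const, measure_univ, one_smul]
  have hsel (p : ℕ) : selProb ν Y X c p = (iidGaussian (Fin n) (σ ^ 2).toNNReal).real
      {x | select X c (σ * scaledResid n P σ (residMat X *ᵥ x)) (X *ᵥ θ + x) = p} := by
    refine Eq.trans ?_ (measureReal_setOf_hasLaw hu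
      (measurable_select hX θ c hf (measurableSet_singleton p)))
    simp only [selProb, pHat, hY, sigmaHat_eq_scaledResid hX θ hσ]
  have hselStar (p : ℕ) : selProbStar ν Y X σ c p = (iidGaussian (Fin n) (σ ^ 2).toNNReal).real
      {x | select X c (σ * 1) (X *ᵥ θ + x) = p} := by
    refine Eq.trans ?_ (measureReal_setOf_hasLaw hu
      (measurable_select (σ := σ) hX θ c hf1 (measurableSet_singleton p)))
    simp only [selProbStar, pHatStar, hY, mul_one]
  refine ⟨?_, ?_, fun p hOp hpP => ?_, ?_, fun p hOp hpP => ?_, fun t => ?_, fun t => ?_⟩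
  · have hfm : Measurable fun x => scaledResid n P σ (residMat X *ᵥ x) :=
      hf.comp (measurable_mulVec _)
    have h : HasLaw (fun x => scaledResid n P σ (residMat X *ᵥ x))
        (volume.withDensity fun s => ENNReal.ofReal (chiDensity (n - P) s))
        (iidGaussian (Fin n) (σ ^ 2).toNNReal) :=
      ⟨hfm.aemeasurable, map_scaledResid hPn hX hσ⟩
    have h' := h.comp hu
    refine h'.congr (Filter.Eventually.of_forall fun ω => ?_)
    simp only [hY, sigmaHat_eq_scaledResid hX θ hσ, Function.comp_apply,
      mul_div_cancel_left₀ _ hσ.ne']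
  · rw [hselStar, measureReal_select_eq_min' hn hX θ hσ hO.le hcO hf1 hpos1, hρ1, integral_dirac]
  · rw [hselStar, measureReal_select_eq' hn hX θ hσ (by omega) hpP hf1 hpos1, hρ1, integral_dirac]
  · rw [hsel, measureReal_select_eq_min' hn hX θ hσ hO.le hcO hf hpos, map_scaledResid hPn hX hσ,
      integral_withDensity_chiDensity]
  · rw [hsel, measureReal_select_eq' hn hX θ hσ (by omega) hpP hf hpos, map_scaledResid hPn hX hσ,
      integral_withDensity_chiDensity]
  · have h := measureReal_postSelection_le hn hX A θ hσ hO.le hcO hS hf1 hpos1 t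
    rw [← measureReal_setOf_hasLaw hu
      (measurableSet_postSelection_le hX A θ hO.le hcO.le hf1 t), hρ1] at h
    -- At `s = 1` the product over later orders is independent of `z` and leaves the integral. For
    -- an unknown variance it depends on `s` and has to stay inside.
    simp only [mul_one, integral_dirac, integral_mul_const] at h
    simp only [cdfGStar, postLSStar, pHatStar, hY]
    exact h
  · have h := measureReal_postSelection_le hn hX A θ hσ hO.le hcO hS hf hpos t
    rw [← measureReal_setOf_hasLaw hu
      (measurableSet_postSelection_le hX A θ hO.le hcO.le hf t), map_scaledResid hPn hX hσ] at h
    simp only [integral_withDensity_chiDensity] at h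
    simp only [cdfG, postLS, pHat, hY, sigmaHat_eq_scaledResid hX θ hσ]
    exact h
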